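/- Let $\mathbb{T}=\mathbb{R}/\mathbb{Z}$ be the circle of length $1$, and let $\mathrm{Diff}^k(\mathbb{T})$ be the set of orientation-preserving $C^k$-diffeomorphisms of $\mathbb{T}$; $\mathrm{Diff}^1(\mathbb{T})$ carries the $C^1$-topology and its Borel $\sigma$-algebra. For $\psi\in\mathrm{Diff}^3(\mathbb{T})$ write $\mathcal{S}_\psi=\left(\frac{\psi''}{\psi'}\right)'-\frac12\left(\frac{\psi''}{\psi'}\right)^2$ for its Schwarzian derivative. Fix $\sigma^2>0$; the parameter $\alpha$ is a complex number with $\alpha^2\in\mathbb{R}$. A Radon measure $\mu$ on $\mathrm{Diff}^1(\mathbb{T})$ is called an unquotiented $\alpha$-orbital measure if for every $\psi\in\mathrm{Diff}^3(\mathbb{T})$ the pullback $\psi^*\mu(A)=\mu(\psi\circ A)$ is absolutely continuous with respect to $\mu$ with density $$\frac{\mathrm{d}\psi^*\mu}{\mathrm{d}\mu}(\phi)=\exp\left\{\frac1{\sigma^2}\int_{\mathbb{T}}\Big[\mathcal{S}_\psi(\phi(\tau))+2\alpha^2\big(\psi'(\phi(\tau))^2-1\big)\Big]\phi'(\tau)^2\,\mathrm{d}\tau\right\}.$$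 Let $\mathcal{M}^{\alpha_0}$ be an unquotiented $\alpha_0$-orbital measure for some $\alpha_0$ with $\alpha_0^2\in\mathbb{R}$, and for all $\alpha^2\in\mathbb{R}$ let $$\mathrm{d}\mathcal{M}^{\alpha}(\phi)=\exp\left\{\frac{2(\alpha^2-\alpha_0^2)}{\sigma^2}\int_{\mathbb{T}}\phi'(\tau)^2\,\mathrm{d}\tau\right\}\mathrm{d}\mathcal{M}^{\alpha_0}(\phi).$$ Assume that the family is regular, i.e. $\mathcal{M}^{\alpha}$ has finite total mass for at least one $\alpha^2\in\mathbb{R}$. Write $\mathcal{Z}(\sigma^2,\alpha)=\mathcal{M}^{\alpha}(\mathrm{Diff}^1(\mathbb{T}))$ for the total mass. Then for every $\alpha$ with $\alpha^2\in\mathbb{R}$ and $\alpha^2<\pi^2$, the total mass $\mathcal{Z}(\sigma^2,\alpha)$ is finite and $$\mathcal{Z}(\sigma^2,\alpha)=\frac{\alpha}{\sin\alpha}\,e^{2\alpha^2/\sigma^2}\,\mathcal{Z}(\sigma^2,0),$$ where $\frac{\alpha}{\sin\alpha}$ is understood as $1$ for $\alpha=0$. -/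

import Mathlib

open MeasureTheory
open scoped ENNReal

noncomputable section

/-- The Schwarzian derivative `S(f, x) = (f'' / f')'(x) - (1/2) (f''(x) / f'(x))²`. -/
def schwarzian (f : ℝ → ℝ) (x : ℝ) : ℝ :=
  deriv (fun y => deriv (deriv f) y / deriv f y) x - 1 / 2 * (deriv (deriv f) x / deriv f x) ^ 2

/-- `Φ : ℝ → ℝ` is the lift of an orientation-preserving `C^k`-diffeomorphism of the unit circle
`ℝ / ℤ`: it is `C^k`, has positive derivative, and commutes with the translation by `1`. -/
structure IsDiffLift (k : ℕ) (Φ : ℝ → ℝ) : Prop where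
  contDiff : ContDiff ℝ k Φ
  deriv_pos : ∀ x, 0 < deriv Φ x
  map_add_one : ∀ x, Φ (x + 1) = Φ x + 1

theorem IsDiffLift.deriv_periodic {k : ℕ} {Φ : ℝ → ℝ} (h : IsDiffLift k Φ) :
    Function.Periodic (deriv Φ) 1 := by
  intro x
  have h1 : (fun y => Φ (y + 1)) = fun y => Φ y + 1 := funext h.map_add_one
  rw [← deriv_comp_add_const Φ 1 x, h1, deriv_add_const]

theorem periodic_deriv_one {g : ℝ → ℝ} (h : Function.Periodic g 1) :
    Function.Periodic (deriv g) 1 := by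
  intro x
  have h1 : (fun y => g (y + 1)) = g := funext h
  rw [← deriv_comp_add_const g 1 x, h1]

theorem IsDiffLift.schwarzian_periodic {k : ℕ} {Φ : ℝ → ℝ} (h : IsDiffLift k Φ) :
    Function.Periodic (schwarzian Φ) 1 := by
  have h1 := h.deriv_periodic
  have h2 := periodic_deriv_one h1
  have h3 := periodic_deriv_one (g := fun y => deriv (deriv Φ) y / deriv Φ y)
    (fun y => by simp only [h1 y, h2 y])
  intro x
  simp only [schwarzian, h1 x, h2 x, h3 x]

/-- `Diff^k(𝕋)` for `k ≥ 1`: the orientation-preserving `C^k`-diffeomorphisms of the circle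
`𝕋 = ℝ / ℤ`. They are exactly the self-maps of `𝕋` induced by some `Φ` with `IsDiffLift k Φ`. -/
@[ext]
structure CircleDiff (k : ℕ) where
  toFun : UnitAddCircle → UnitAddCircle
  exists_lift : ∃ Φ : ℝ → ℝ, IsDiffLift k Φ ∧ ∀ x : ℝ, toFun (x : UnitAddCircle) = (Φ x : ℝ)

namespace CircleDiff

variable {k : ℕ}

/-- A lift to `ℝ`; it is determined up to an integer constant, and only quantities that do not
depend on that constant are formed from it. -/
def lift (φ : CircleDiff k) : ℝ → ℝ := φ.exists_lift.choose

theorem isDiffLift_lift (φ : CircleDiff k) : IsDiffLift k φ.lift :=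
  φ.exists_lift.choose_spec.1

theorem coe_lift (φ : CircleDiff k) (x : ℝ) : φ.toFun (x : UnitAddCircle) = (φ.lift x : ℝ) :=
  φ.exists_lift.choose_spec.2 x

/-- The derivative `φ' : 𝕋 → ℝ`. -/
def deriv (φ : CircleDiff k) : UnitAddCircle → ℝ :=
  φ.isDiffLift_lift.deriv_periodic.lift

/-- The Schwarzian derivative `S_φ : 𝕋 → ℝ` (meaningful for `k ≥ 3`). -/
def schwarzian (φ : CircleDiff k) : UnitAddCircle → ℝ :=
  φ.isDiffLift_lift.schwarzian_periodic.lift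

theorem continuous_toFun (φ : CircleDiff k) : Continuous φ.toFun := by
  refine (QuotientAddGroup.isQuotientMap_mk (N := AddSubgroup.zmultiples (1 : ℝ))).continuous_iff.2 ?_
  have h : (φ.toFun ∘ fun x : ℝ => (x : UnitAddCircle)) = fun x => ((φ.lift x : ℝ) : UnitAddCircle) :=
    funext φ.coe_lift
  exact h ▸ (AddCircle.continuous_mk' 1).comp φ.isDiffLift_lift.contDiff.continuous

theorem continuous_deriv (φ : CircleDiff 1) : Continuous φ.deriv :=
  continuous_quot_lift _ (φ.isDiffLift_lift.contDiff.continuous_deriv le_rfl)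

/-- The `C¹`-topology on `Diff¹(𝕋)`: uniform convergence of `φ` and of `φ'`. -/
instance : TopologicalSpace (CircleDiff 1) :=
  TopologicalSpace.induced
    (fun φ => ((⟨φ.toFun, φ.continuous_toFun⟩, ⟨φ.deriv, φ.continuous_deriv⟩) :
      C(UnitAddCircle, UnitAddCircle) × C(UnitAddCircle, ℝ)))
    inferInstance

instance : MeasurableSpace (CircleDiff 1) := borel _

instance : BorelSpace (CircleDiff 1) := ⟨rfl⟩

/-- Post-composition `φ ↦ ψ ∘ φ` of `φ ∈ Diff¹(𝕋)` with `ψ ∈ Diff³(𝕋)`. -/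
def postcomp (ψ : CircleDiff 3) (φ : CircleDiff 1) : CircleDiff 1 where
  toFun := ψ.toFun ∘ φ.toFun
  exists_lift := by
    have hψ := ψ.isDiffLift_lift
    have hφ := φ.isDiffLift_lift
    have hψ1 : ContDiff ℝ 1 ψ.lift := hψ.contDiff.of_le (by norm_num)
    refine ⟨ψ.lift ∘ φ.lift, ⟨hψ1.comp hφ.contDiff, fun x => ?_, fun x => ?_⟩, fun x => ?_⟩
    · rw [deriv_comp x (hψ1.differentiable one_ne_zero _)
        (hφ.contDiff.differentiable one_ne_zero _)]
      exact mul_pos (hψ.deriv_pos _) (hφ.deriv_pos _)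
    · simp only [Function.comp_apply, hφ.map_add_one, hψ.map_add_one]
    · simp only [Function.comp_apply, coe_lift]

/-- The Dirichlet energy `∫_𝕋 φ'(τ)² dτ`, with `𝕋` of total length `1`. -/
def energy (φ : CircleDiff 1) : ℝ := ∫ τ : UnitAddCircle, φ.deriv τ ^ 2

end CircleDiff

/-- Radon measure: locally finite and inner regular with respect to compact sets. -/
def IsRadonMeasure (μ : Measure (CircleDiff 1)) : Prop :=
  IsLocallyFiniteMeasure μ ∧ μ.InnerRegular

/-- The density
`exp {(1/σ²) ∫_𝕋 [S_ψ(φ(τ)) + 2 α² (ψ'(φ(τ))² - 1)] φ'(τ)² dτ}` of the change of variables formula;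
here `σsq` stands for `σ²` and `a` for the real number `α²`. -/
def orbitalDensity (σsq a : ℝ) (ψ : CircleDiff 3) (φ : CircleDiff 1) : ℝ :=
  Real.exp (1 / σsq * ∫ τ : UnitAddCircle,
    (ψ.schwarzian (φ.toFun τ) + 2 * a * (ψ.deriv (φ.toFun τ) ^ 2 - 1)) * φ.deriv τ ^ 2)

/-- `μ` is an unquotiented Virasoro `α`-orbital measure, with `σsq = σ²` and `a = α²`: a Radon
measure such that, for all `ψ ∈ Diff³(𝕋)`, the pullback `ψ^* μ : A ↦ μ (ψ ∘ A)` is absolutely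
continuous with respect to `μ` with density `orbitalDensity σsq a ψ`. -/
structure IsOrbitalMeasure (σsq a : ℝ) (μ : Measure (CircleDiff 1)) : Prop where
  radon : IsRadonMeasure μ
  change_of_variables : ∀ ψ : CircleDiff 3, ∀ A : Set (CircleDiff 1), MeasurableSet A →
    μ (ψ.postcomp '' A) = ∫⁻ φ in A, ENNReal.ofReal (orbitalDensity σsq a ψ φ) ∂μ

/-- The reweighted measure `exp {(2 (α² - α₀²) / σ²) ∫_𝕋 φ'(τ)² dτ} dμ(φ)`, with `σsq = σ²`,
`a₀ = α₀²`, `a = α²`. -/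
def changeOfOrbit (σsq a₀ a : ℝ) (μ : Measure (CircleDiff 1)) : Measure (CircleDiff 1) :=
  μ.withDensity fun φ => ENNReal.ofReal (Real.exp (2 * (a - a₀) / σsq * φ.energy))

/-- A regular unquotiented orbital measure: some reweighting of it has finite total mass. -/
structure IsRegularOrbitalMeasure (σsq a₀ : ℝ) (μ : Measure (CircleDiff 1)) : Prop where
  orbital : IsOrbitalMeasure σsq a₀ μ
  regular : ∃ a : ℝ, changeOfOrbit σsq a₀ a μ Set.univ < ∞

/-- A family `a = α² ↦ μ a` of measures obtained from one regular unquotiented orbital measure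
`μ a₀` by exponential reweighting. -/
def IsRegularOrbitalFamily (σsq : ℝ) (μ : ℝ → Measure (CircleDiff 1)) : Prop :=
  ∃ a₀ : ℝ, IsRegularOrbitalMeasure σsq a₀ (μ a₀) ∧ ∀ a : ℝ, μ a = changeOfOrbit σsq a₀ a (μ a₀)

/-- `α / sin α`, equal to `1` at `α = 0`. -/
def divSin (α : ℂ) : ℂ := if α = 0 then 1 else α / Complex.sin α

end

open Filter Topology

/-! ### Lifts of circle diffeomorphisms -/

/-! Write Z(a) for the total mass at a = α², and E(φ) for the energy, the integral of φ'². Up to the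
factor 1/σ², the change of variables replaces the exponent 2aE(φ) by the integral of V(φ)φ'², where
V = S_ψ + 2aψ'² ranges over potentials in the Virasoro coadjoint orbit of the constant 2a; Z(a) is
unchanged (`IsRegularOrbitalFamily.measure_univ_eq_lintegral_postcomp`).

For a = -l² and 0 < b < l, the orbit is approached at the singular potential -2b² - κδ with κ =
4b(cosh l - cosh b)/sinh b. This κ gives the Hill equation of the singular potential the monodromy
trace 2 cosh l, that of the constant -2l². `exists_potentials` realizes it by smoothing ρ of the
Dirac mass. Averaging over the position θ = φ(t) of the kink turns δ into φ'(t), with Jacobian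
φ'(t), so in the limit Z(-l²) is the μ 0-integral of ∫ exp((-2b²E - κφ'(t))/σ²) φ'(t) dt
(`IsRegularOrbitalFamily.measure_univ_neg_sq_eq`).

This is a Laplace transform in s = κ/σ². Since ∫ exp(-sφ')φ' ds = 1 over s > 0, integrating it
returns Z(-b²). As s is affine in cosh l, this is a closed equation
(`IsRegularOrbitalFamily.measure_univ_neg_sq_eq_lintegral`): g(b) = Z(-b²) sinh b / b equals 4/σ²
times the integral of l g(l) over l > b. Hence g' = -4bg/σ² and g is a multiple of exp(-2b²/σ²)
(`exists_eq_of_integral_eq`). Regularity guarantees the finiteness needed for large b only.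

Finally Z is the moment generating function of the nonnegative variable 2E/σ². The formula extends
holomorphically to a disc that reaches π², the first zero of sin √w / √w. Its Taylor coefficients at
the centre are nonnegative moments, so both finiteness and equality propagate to the right
(`lintegral_exp_eq_of_eventuallyEq`). The value at 0 fixes the constant. -/

theorem UnitAddCircle.coe_eq_zero_iff_exists_int (x : ℝ) :
    (x : UnitAddCircle) = 0 ↔ ∃ n : ℤ, (n : ℝ) = x := by
  rw [AddCircle.coe_eq_zero_iff]
  simp

theorem IsDiffLift.differentiable {k : ℕ} {Φ : ℝ → ℝ} (h : IsDiffLift k Φ) (hk : 1 ≤ k) :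
    Differentiable ℝ Φ :=
  h.contDiff.differentiable (by exact_mod_cast (by omega : k ≠ 0))

theorem IsDiffLift.hasDerivAt {k : ℕ} {Φ : ℝ → ℝ} (h : IsDiffLift k Φ) (hk : 1 ≤ k) (x : ℝ) :
    HasDerivAt Φ (deriv Φ x) x :=
  (h.differentiable hk x).hasDerivAt

theorem IsDiffLift.continuous_deriv {k : ℕ} {Φ : ℝ → ℝ} (h : IsDiffLift k Φ) (hk : 1 ≤ k) :
    Continuous (deriv Φ) :=
  h.contDiff.continuous_deriv (by exact_mod_cast hk)

theorem IsDiffLift.strictMono {k : ℕ} {Φ : ℝ → ℝ} (h : IsDiffLift k Φ) : StrictMono Φ :=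
  strictMono_of_deriv_pos h.deriv_pos

theorem IsDiffLift.map_add_nat {k : ℕ} {Φ : ℝ → ℝ} (h : IsDiffLift k Φ) (x : ℝ) (n : ℕ) :
    Φ (x + n) = Φ x + n := by
  induction n with
  | zero => simp
  | succ n ih => push_cast; rw [← add_assoc, h.map_add_one, ih, add_assoc]

theorem IsDiffLift.map_add_int {k : ℕ} {Φ : ℝ → ℝ} (h : IsDiffLift k Φ) (x : ℝ) (n : ℤ) :
    Φ (x + n) = Φ x + n := by
  obtain ⟨m, rfl | rfl⟩ := n.eq_nat_or_neg
  · exact_mod_cast h.map_add_nat x m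
  · have := h.map_add_nat (x + (-(m : ℤ) : ℤ)) m
    push_cast at this ⊢
    rw [neg_add_cancel_right] at this
    linarith

theorem IsDiffLift.surjective {k : ℕ} {Φ : ℝ → ℝ} (h : IsDiffLift k Φ) :
    Function.Surjective Φ := by
  intro y
  have hb : ∀ n : ℤ, Φ n = Φ 0 + n := fun n => by simpa using h.map_add_int 0 n
  have h1 := Int.lt_floor_add_one (y - Φ 0)
  have h2 := Int.floor_le (y - Φ 0)
  have := intermediate_value_Icc (a := ((⌊y - Φ 0⌋ : ℤ) : ℝ)) (b := ((⌊y - Φ 0⌋ + 1 : ℤ) : ℝ))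
    (by push_cast; linarith) h.contDiff.continuous.continuousOn
  obtain ⟨x, -, hx⟩ := this (show y ∈ _ by rw [hb, hb]; push_cast; constructor <;> linarith)
  exact ⟨x, hx⟩

theorem IsDiffLift.comp_sub_const {k : ℕ} {Φ : ℝ → ℝ} (h : IsDiffLift k Φ) (θ : ℝ) :
    IsDiffLift k (fun x => Φ (x - θ)) where
  contDiff := h.contDiff.comp (contDiff_id.sub contDiff_const)
  deriv_pos x := by rw [deriv_comp_sub_const]; exact h.deriv_pos _
  map_add_one x := by rw [add_sub_right_comm, h.map_add_one]

theorem schwarzian_comp_sub_const (f : ℝ → ℝ) (θ x : ℝ) :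
    schwarzian (fun y => f (y - θ)) x = schwarzian f (x - θ) := by
  have h1 : deriv (fun y => f (y - θ)) = fun y => deriv f (y - θ) :=
    funext fun y => deriv_comp_sub_const f θ y
  have h2 : deriv (fun y => deriv f (y - θ)) = fun y => deriv (deriv f) (y - θ) :=
    funext fun y => deriv_comp_sub_const (deriv f) θ y
  have h3 := deriv_comp_sub_const (fun y => deriv (deriv f) y / deriv f y) θ x
  simp only [schwarzian, h1, h2, h3]

theorem schwarzian_add_const (f : ℝ → ℝ) (c x : ℝ) :
    schwarzian (fun y => f y + c) x = schwarzian f x := by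
  have h1 : deriv (fun y => f y + c) = deriv f := funext fun y => deriv_add_const c
  simp only [schwarzian, h1]

theorem IsDiffLift.continuous_schwarzian {Φ : ℝ → ℝ} (h : IsDiffLift 3 Φ) :
    Continuous (schwarzian Φ) := by
  have h1 : ContDiff ℝ 2 (deriv Φ) := by
    have := h.contDiff
    rw [show ((3 : ℕ) : WithTop ℕ∞) = 2 + 1 by norm_num, contDiff_succ_iff_deriv] at this
    exact this.2.2
  have h2 : ContDiff ℝ 1 (deriv (deriv Φ)) := by
    have := h1
    rw [show (2 : WithTop ℕ∞) = 1 + 1 by norm_num, contDiff_succ_iff_deriv] at this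
    exact this.2.2
  have h3 : ContDiff ℝ 1 (fun y => deriv (deriv Φ) y / deriv Φ y) :=
    h2.div (h1.of_le (by norm_num)) fun x => (h.deriv_pos x).ne'
  unfold schwarzian
  exact (h3.continuous_deriv le_rfl).sub (continuous_const.mul (h3.continuous.pow 2))

/-- The difference of two lifts is continuous and integer-valued, hence constant. Derivatives and
Schwarzians may therefore be computed from any convenient lift. -/
theorem IsDiffLift.exists_lift_eq_add_const {k : ℕ} {φ : CircleDiff k} {Φ : ℝ → ℝ}
    (h : IsDiffLift k Φ) (hφ : ∀ x : ℝ, φ.toFun (x : UnitAddCircle) = (Φ x : ℝ)) :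
    ∃ c : ℝ, φ.lift = fun x => Φ x + c := by
  have h1 : ∀ x, ∃ n : ℤ, (n : ℝ) = φ.lift x - Φ x := fun x => by
    rw [← UnitAddCircle.coe_eq_zero_iff_exists_int, AddCircle.coe_sub, sub_eq_zero, ← hφ,
      φ.coe_lift]
  choose n hn using h1
  have hc : Continuous n := by
    rw [Int.isClosedEmbedding_coe_real.isEmbedding.continuous_iff]
    have : ((↑) : ℤ → ℝ) ∘ n = fun x => φ.lift x - Φ x := funext hn
    rw [this]
    exact φ.isDiffLift_lift.contDiff.continuous.sub h.contDiff.continuous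
  refine ⟨n 0, funext fun x => ?_⟩
  rw [PreconnectedSpace.constant (Y := ℤ) inferInstance hc (x := 0) (y := x), hn]
  ring

namespace CircleDiff

variable {k : ℕ}

theorem deriv_coe_lift (φ : CircleDiff k) (x : ℝ) :
    φ.deriv (x : UnitAddCircle) = _root_.deriv φ.lift x := rfl

theorem deriv_coe {φ : CircleDiff k} {Φ : ℝ → ℝ} (h : IsDiffLift k Φ)
    (hφ : ∀ x : ℝ, φ.toFun (x : UnitAddCircle) = (Φ x : ℝ)) (x : ℝ) :
    φ.deriv (x : UnitAddCircle) = _root_.deriv Φ x := by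
  obtain ⟨c, hc⟩ := h.exists_lift_eq_add_const hφ
  rw [deriv_coe_lift, hc, deriv_add_const]

theorem schwarzian_coe {φ : CircleDiff k} {Φ : ℝ → ℝ} (h : IsDiffLift k Φ)
    (hφ : ∀ x : ℝ, φ.toFun (x : UnitAddCircle) = (Φ x : ℝ)) (x : ℝ) :
    φ.schwarzian (x : UnitAddCircle) = _root_.schwarzian Φ x := by
  obtain ⟨c, hc⟩ := h.exists_lift_eq_add_const hφ
  change _root_.schwarzian φ.lift x = _
  rw [hc, schwarzian_add_const]

/-- The circle diffeomorphism induced by a lift. -/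
def ofLift (Φ : ℝ → ℝ) (h : IsDiffLift k Φ) : CircleDiff k where
  toFun := Function.Periodic.lift (f := fun x => ((Φ x : ℝ) : UnitAddCircle)) (c := 1)
    fun x => by
      beta_reduce
      rw [h.map_add_one, AddCircle.coe_add, AddCircle.coe_period, add_zero]
  exists_lift := ⟨Φ, h, fun _ => rfl⟩

theorem ofLift_coe (Φ : ℝ → ℝ) (h : IsDiffLift k Φ) (x : ℝ) :
    (ofLift Φ h).toFun (x : UnitAddCircle) = (Φ x : ℝ) := rfl

theorem deriv_pos (φ : CircleDiff k) (τ : UnitAddCircle) : 0 < φ.deriv τ := by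
  induction τ using QuotientAddGroup.induction_on with
  | H x => exact φ.isDiffLift_lift.deriv_pos x

theorem deriv_postcomp (ψ : CircleDiff 3) (φ : CircleDiff 1) (τ : UnitAddCircle) :
    (ψ.postcomp φ).deriv τ = ψ.deriv (φ.toFun τ) * φ.deriv τ := by
  induction τ using QuotientAddGroup.induction_on with
  | H x =>
    have hψ := ψ.isDiffLift_lift
    have hφ := φ.isDiffLift_lift
    have hψ1 : ContDiff ℝ 1 ψ.lift := hψ.contDiff.of_le (by norm_num)
    have hd : _root_.deriv (ψ.lift ∘ φ.lift)
        = fun x => _root_.deriv ψ.lift (φ.lift x) * _root_.deriv φ.lift x :=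
      funext fun x => deriv_comp x (hψ1.differentiable one_ne_zero _)
        (hφ.contDiff.differentiable one_ne_zero _)
    have h : IsDiffLift 1 (ψ.lift ∘ φ.lift) :=
      ⟨hψ1.comp hφ.contDiff, fun x => by rw [hd]; exact mul_pos (hψ.deriv_pos _) (hφ.deriv_pos _),
        fun x => by simp only [Function.comp_apply, hφ.map_add_one, hψ.map_add_one]⟩
    have h2 := deriv_coe (φ := ψ.postcomp φ) h
      (fun x => by
        change ψ.toFun (φ.toFun (x : UnitAddCircle)) = _
        rw [coe_lift, coe_lift, Function.comp_apply]) x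
    change (ψ.postcomp φ).deriv (x : UnitAddCircle)
      = ψ.deriv (φ.toFun (x : UnitAddCircle)) * φ.deriv (x : UnitAddCircle)
    rw [h2, hd, coe_lift, deriv_coe_lift, deriv_coe_lift]

/-- The preimage is obtained by composing with the inverse of the lift of ψ. It makes every set of
diffeomorphisms an image under post-composition, which the change of variables for integrals
requires. -/
theorem postcomp_surjective (ψ : CircleDiff 3) : Function.Surjective ψ.postcomp := by
  intro χ
  have hψ := ψ.isDiffLift_lift
  have hχ := χ.isDiffLift_lift
  let e := StrictMono.orderIsoOfSurjective ψ.lift hψ.strictMono hψ.surjective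
  have he : ∀ y, ψ.lift (e.symm y) = y := fun y => e.apply_symm_apply y
  have hec : Continuous e.symm := e.symm.continuous
  have hed : ∀ y, HasDerivAt e.symm (_root_.deriv ψ.lift (e.symm y))⁻¹ y := fun y =>
    HasDerivAt.of_local_left_inverse hec.continuousAt (hψ.hasDerivAt (by norm_num) _)
      (hψ.deriv_pos _).ne' (Eventually.of_forall he)
  have hed' : _root_.deriv e.symm = fun y => (_root_.deriv ψ.lift (e.symm y))⁻¹ :=
    funext fun y => (hed y).deriv
  have he1 : ContDiff ℝ 1 e.symm := by
    rw [contDiff_one_iff_deriv]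
    refine ⟨fun y => (hed y).differentiableAt, ?_⟩
    rw [hed']
    exact ((hψ.continuous_deriv (by norm_num)).comp hec).inv₀ fun y => (hψ.deriv_pos _).ne'
  have hl : IsDiffLift 1 (e.symm ∘ χ.lift) := by
    refine ⟨he1.comp hχ.contDiff, fun x => ?_, fun x => ?_⟩
    · rw [deriv_comp x (hed _).differentiableAt (hχ.differentiable le_rfl _), hed']
      exact mul_pos (inv_pos.2 (hψ.deriv_pos _)) (hχ.deriv_pos _)
    · apply hψ.strictMono.injective
      simp only [Function.comp_apply, hψ.map_add_one, he, hχ.map_add_one]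
  refine ⟨ofLift _ hl, ?_⟩
  ext τ
  induction τ using QuotientAddGroup.induction_on with
  | H x =>
    change ψ.toFun ((ofLift _ hl).toFun (x : UnitAddCircle)) = χ.toFun (x : UnitAddCircle)
    rw [ofLift_coe, coe_lift, coe_lift, Function.comp_apply, he]

/-! ### Continuity in the `C¹` topology -/

theorem continuous_toFun_apply :
    Continuous fun p : CircleDiff 1 × UnitAddCircle => p.1.toFun p.2 := by
  have h : Continuous fun φ : CircleDiff 1 =>
      ((⟨φ.toFun, φ.continuous_toFun⟩, ⟨φ.deriv, φ.continuous_deriv⟩) :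
        C(UnitAddCircle, UnitAddCircle) × C(UnitAddCircle, ℝ)) := continuous_induced_dom
  exact (continuous_eval (F := C(UnitAddCircle, UnitAddCircle))).comp
    ((h.fst.comp continuous_fst).prodMk continuous_snd)

theorem continuous_deriv_apply :
    Continuous fun p : CircleDiff 1 × UnitAddCircle => p.1.deriv p.2 := by
  have h : Continuous fun φ : CircleDiff 1 =>
      ((⟨φ.toFun, φ.continuous_toFun⟩, ⟨φ.deriv, φ.continuous_deriv⟩) :
        C(UnitAddCircle, UnitAddCircle) × C(UnitAddCircle, ℝ)) := continuous_induced_dom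
  exact (continuous_eval (F := C(UnitAddCircle, ℝ))).comp
    ((h.snd.comp continuous_fst).prodMk continuous_snd)

end CircleDiff

theorem ContinuousMap.continuous_integral_unitAddCircle :
    Continuous fun f : C(UnitAddCircle, ℝ) => ∫ τ, f τ := by
  refine LipschitzWith.continuous (K := 1) (LipschitzWith.of_dist_le_mul fun f g => ?_)
  have hi : ∀ f : C(UnitAddCircle, ℝ), Integrable (fun τ => f τ) := fun f =>
    f.continuous.integrable_of_hasCompactSupport (HasCompactSupport.of_compactSpace _)
  rw [dist_eq_norm, ← integral_sub (hi f) (hi g), NNReal.coe_one, one_mul]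
  have := norm_integral_le_of_norm_le_const (μ := (volume : Measure UnitAddCircle))
    (f := fun τ => f τ - g τ) (C := dist f g)
    (Eventually.of_forall fun τ => by rw [← dist_eq_norm]; exact ContinuousMap.dist_apply_le_dist τ)
  simpa [measureReal_def] using this

/-- Currying turns joint continuity into continuity in the uniform norm on the circle, where
integration is 1-Lipschitz. -/
theorem continuous_integral_unitAddCircle {X : Type*} [TopologicalSpace X]
    {f : X → UnitAddCircle → ℝ} (hf : Continuous (Function.uncurry f)) :
    Continuous fun x => ∫ τ, f x τ := by
  let F : C(X × UnitAddCircle, ℝ) := ⟨Function.uncurry f, hf⟩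
  exact ContinuousMap.continuous_integral_unitAddCircle.comp F.curry.continuous

/-! ### Continuity of post-composition and of integral functionals of φ. -/

namespace CircleDiff

theorem continuous_postcomp (ψ : CircleDiff 3) : Continuous ψ.postcomp := by
  have hψ : Continuous ψ.deriv :=
    continuous_quot_lift _ (ψ.isDiffLift_lift.continuous_deriv (by norm_num))
  let F : C(CircleDiff 1 × UnitAddCircle, UnitAddCircle) :=
    ⟨fun p => ψ.toFun (p.1.toFun p.2), ψ.continuous_toFun.comp continuous_toFun_apply⟩
  let G : C(CircleDiff 1 × UnitAddCircle, ℝ) :=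
    ⟨fun p => ψ.deriv (p.1.toFun p.2) * p.1.deriv p.2,
      (hψ.comp continuous_toFun_apply).mul continuous_deriv_apply⟩
  refine continuous_induced_rng.2 ?_
  have : ((fun φ => ((⟨φ.toFun, φ.continuous_toFun⟩, ⟨φ.deriv, φ.continuous_deriv⟩) :
      C(UnitAddCircle, UnitAddCircle) × C(UnitAddCircle, ℝ))) ∘ ψ.postcomp)
      = fun φ => (F.curry φ, G.curry φ) := by
    funext φ
    refine Prod.ext (by rfl) (ContinuousMap.ext fun τ => ?_)
    exact deriv_postcomp ψ φ τ
  rw [this]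
  exact F.curry.continuous.prodMk G.curry.continuous

theorem continuous_integral_comp_mul_deriv_sq {X : Type*} [TopologicalSpace X]
    {W : X → UnitAddCircle → ℝ} (hW : Continuous (Function.uncurry W)) :
    Continuous fun p : X × CircleDiff 1 =>
      ∫ τ : UnitAddCircle, W p.1 (p.2.toFun τ) * p.2.deriv τ ^ 2 := by
  refine continuous_integral_unitAddCircle
    (f := fun (p : X × CircleDiff 1) τ => W p.1 (p.2.toFun τ) * p.2.deriv τ ^ 2) ?_
  have h1 : Continuous fun q : (X × CircleDiff 1) × UnitAddCircle => (q.1.2, q.2) := by fun_prop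
  have h2 := continuous_toFun_apply.comp h1
  have h3 := continuous_deriv_apply.comp h1
  exact (hW.comp ((continuous_fst.comp continuous_fst).prodMk h2)).mul (h3.pow 2)

theorem continuous_integral_comp_mul_deriv_sq' {W : UnitAddCircle → ℝ} (hW : Continuous W) :
    Continuous fun φ : CircleDiff 1 => ∫ τ : UnitAddCircle, W (φ.toFun τ) * φ.deriv τ ^ 2 :=
  (continuous_integral_comp_mul_deriv_sq (X := Unit) (W := fun _ => W)
    (hW.comp continuous_snd)).comp (continuous_const (y := ()) |>.prodMk continuous_id)

theorem continuous_energy : Continuous energy := by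
  simpa [energy] using! continuous_integral_comp_mul_deriv_sq' (W := fun _ => 1) continuous_const

theorem energy_nonneg (φ : CircleDiff 1) : 0 ≤ φ.energy :=
  integral_nonneg fun _ => sq_nonneg _

theorem integrable_comp_mul_deriv_sq {W : UnitAddCircle → ℝ} (hW : Continuous W)
    (φ : CircleDiff 1) : Integrable fun τ : UnitAddCircle => W (φ.toFun τ) * φ.deriv τ ^ 2 :=
  ((hW.comp φ.continuous_toFun).mul (φ.continuous_deriv.pow 2)).integrable_of_hasCompactSupport
    (HasCompactSupport.of_compactSpace _)

theorem continuous_schwarzian (ψ : CircleDiff 3) : Continuous ψ.schwarzian :=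
  continuous_quot_lift _ ψ.isDiffLift_lift.continuous_schwarzian

theorem continuous_deriv_three (ψ : CircleDiff 3) : Continuous ψ.deriv :=
  continuous_quot_lift _ (ψ.isDiffLift_lift.continuous_deriv (by norm_num))

end CircleDiff

/-! ### The change of variables formula for functions -/

section ChangeOfVariables

open CircleDiff

theorem measurable_orbitalDensity (σsq a : ℝ) (ψ : CircleDiff 3) :
    Measurable (orbitalDensity σsq a ψ) := by
  have := continuous_integral_comp_mul_deriv_sq'
    (W := fun x => ψ.schwarzian x + 2 * a * (ψ.deriv x ^ 2 - 1))
    (ψ.continuous_schwarzian.add (continuous_const.mul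
      ((ψ.continuous_deriv_three.pow 2).sub continuous_const)))
  exact (Real.continuous_exp.comp (continuous_const.mul this)).measurable

/-- The orbital property, applied to preimages, says that μ is the pushforward under
post-composition of μ weighted by the density. -/
theorem IsOrbitalMeasure.lintegral_eq {σsq a : ℝ} {μ : Measure (CircleDiff 1)}
    (hμ : IsOrbitalMeasure σsq a μ) (ψ : CircleDiff 3) {F : CircleDiff 1 → ℝ≥0∞}
    (hF : Measurable F) :
    ∫⁻ φ, F φ ∂μ = ∫⁻ φ, ENNReal.ofReal (orbitalDensity σsq a ψ φ) * F (ψ.postcomp φ) ∂μ := by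
  have hd := (measurable_orbitalDensity σsq a ψ).ennreal_ofReal
  have hp := ψ.continuous_postcomp.measurable
  have h : μ = (μ.withDensity fun φ => ENNReal.ofReal (orbitalDensity σsq a ψ φ)).map
      ψ.postcomp := by
    ext B hB
    rw [Measure.map_apply hp hB, withDensity_apply _ (hp hB),
      ← hμ.change_of_variables ψ _ (hp hB), Set.image_preimage_eq _ ψ.postcomp_surjective]
  conv_lhs => rw [h]
  rw [lintegral_map hF hp, lintegral_withDensity_eq_lintegral_mul _ hd (g := fun φ => F (ψ.postcomp φ)) (hF.comp hp)]
  rfl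

theorem energy_postcomp (ψ : CircleDiff 3) (φ : CircleDiff 1) :
    (ψ.postcomp φ).energy = ∫ τ : UnitAddCircle, ψ.deriv (φ.toFun τ) ^ 2 * φ.deriv τ ^ 2 := by
  simp only [energy, deriv_postcomp, mul_pow]

/-- The total masses of a family of measures in terms of its member `μ 0`. -/
theorem IsRegularOrbitalFamily.measure_univ {σsq : ℝ} {μ : ℝ → Measure (CircleDiff 1)}
    (hμ : IsRegularOrbitalFamily σsq μ) (a : ℝ) :
    μ a Set.univ = ∫⁻ φ, ENNReal.ofReal (Real.exp (2 * a / σsq * φ.energy)) ∂μ 0 := by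
  obtain ⟨a₀, -, h⟩ := hμ
  have hm : ∀ c : ℝ, Measurable fun φ : CircleDiff 1 =>
      ENNReal.ofReal (Real.exp (c * φ.energy)) := fun c =>
    (Real.continuous_exp.comp (continuous_const.mul continuous_energy)).measurable.ennreal_ofReal
  rw [h a, h 0, changeOfOrbit, changeOfOrbit, lintegral_withDensity_eq_lintegral_mul _ (hm _) (hm _),
    withDensity_apply _ MeasurableSet.univ, Measure.restrict_univ]
  refine lintegral_congr fun φ => ?_
  rw [Pi.mul_apply, ← ENNReal.ofReal_mul (Real.exp_nonneg _), ← Real.exp_add]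
  congr 2
  ring

/-- The base parameter a₀ cancels: the density contributes 2a₀(ψ'² - 1), the transformed weight 2(a
- a₀)ψ'², and passing from `μ a₀` to `μ 0` absorbs the remaining -2a₀. -/
theorem IsRegularOrbitalFamily.measure_univ_eq_lintegral_postcomp {σsq : ℝ}
    {μ : ℝ → Measure (CircleDiff 1)} (hμ : IsRegularOrbitalFamily σsq μ) (a : ℝ) (ψ : CircleDiff 3) :
    μ a Set.univ = ∫⁻ φ, ENNReal.ofReal (Real.exp (1 / σsq * ∫ τ : UnitAddCircle,
      (ψ.schwarzian (φ.toFun τ) + 2 * a * ψ.deriv (φ.toFun τ) ^ 2) * φ.deriv τ ^ 2)) ∂μ 0 := by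
  obtain ⟨a₀, hr, h⟩ := hμ
  have hm : ∀ c : ℝ, Measurable fun φ : CircleDiff 1 =>
      ENNReal.ofReal (Real.exp (c * φ.energy)) := fun c =>
    (Real.continuous_exp.comp (continuous_const.mul continuous_energy)).measurable.ennreal_ofReal
  have hS := ψ.continuous_schwarzian
  have hD := ψ.continuous_deriv_three
  have hc := continuous_integral_comp_mul_deriv_sq'
    (W := fun x => ψ.schwarzian x + 2 * a * ψ.deriv x ^ 2)
    (hS.add (continuous_const.mul (hD.pow 2)))
  have hm2 : Measurable fun φ : CircleDiff 1 =>
      ENNReal.ofReal (Real.exp (1 / σsq * ∫ τ : UnitAddCircle,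
      (ψ.schwarzian (φ.toFun τ) + 2 * a * ψ.deriv (φ.toFun τ) ^ 2) * φ.deriv τ ^ 2)) :=
    (Real.continuous_exp.comp (continuous_const.mul hc)).measurable.ennreal_ofReal
  rw [h a, h 0, changeOfOrbit, changeOfOrbit, lintegral_withDensity_eq_lintegral_mul _ (hm _) hm2,
    withDensity_apply _ MeasurableSet.univ, Measure.restrict_univ, hr.orbital.lintegral_eq ψ (hm _)]
  refine lintegral_congr fun φ => ?_
  rw [Pi.mul_apply, ← ENNReal.ofReal_mul (Real.exp_nonneg _), orbitalDensity,
    ← ENNReal.ofReal_mul (Real.exp_nonneg _), ← Real.exp_add, ← Real.exp_add, energy_postcomp,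
    energy]
  congr 2
  have i1 := integrable_comp_mul_deriv_sq hS φ
  have i2 := integrable_comp_mul_deriv_sq (W := fun x => ψ.deriv x ^ 2) (hD.pow 2) φ
  have i3 : Integrable fun τ : UnitAddCircle => φ.deriv τ ^ 2 := by
    simpa using integrable_comp_mul_deriv_sq (W := fun _ => 1) continuous_const φ
  have i4 : Integrable fun τ : UnitAddCircle =>
      ψ.deriv (φ.toFun τ) ^ 2 * φ.deriv τ ^ 2 - φ.deriv τ ^ 2 := i2.sub i3
  have e1 : ∫ τ : UnitAddCircle,
      (ψ.schwarzian (φ.toFun τ) + 2 * a₀ * (ψ.deriv (φ.toFun τ) ^ 2 - 1)) * φ.deriv τ ^ 2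
      = (∫ τ : UnitAddCircle, ψ.schwarzian (φ.toFun τ) * φ.deriv τ ^ 2)
        + 2 * a₀ * ((∫ τ : UnitAddCircle, ψ.deriv (φ.toFun τ) ^ 2 * φ.deriv τ ^ 2)
          - ∫ τ : UnitAddCircle, φ.deriv τ ^ 2) := by
    rw [← integral_sub i2 i3, ← integral_const_mul, ← integral_add i1 (i4.const_mul _)]
    refine integral_congr_ae (Eventually.of_forall fun τ => ?_)
    ring
  have e2 : ∫ τ : UnitAddCircle,
      (ψ.schwarzian (φ.toFun τ) + 2 * a * ψ.deriv (φ.toFun τ) ^ 2) * φ.deriv τ ^ 2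
      = (∫ τ : UnitAddCircle, ψ.schwarzian (φ.toFun τ) * φ.deriv τ ^ 2)
        + 2 * a * ∫ τ : UnitAddCircle, ψ.deriv (φ.toFun τ) ^ 2 * φ.deriv τ ^ 2 := by
    rw [← integral_const_mul, ← integral_add i1 (i2.const_mul _)]
    refine integral_congr_ae (Eventually.of_forall fun τ => ?_)
    ring
  rw [e1, e2]
  ring

/-- For a lift `Ψ` and a shift `θ`, the total mass as an integral of an exponential of a potential
along the shifted circle. -/
theorem IsRegularOrbitalFamily.measure_univ_eq_of_lift {σsq : ℝ}
    {μ : ℝ → Measure (CircleDiff 1)} (hμ : IsRegularOrbitalFamily σsq μ) (a : ℝ) {Ψ : ℝ → ℝ}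
    (hΨ : IsDiffLift 3 Ψ) (θ : ℝ) :
    μ a Set.univ = ∫⁻ φ, ENNReal.ofReal (Real.exp (1 / σsq * ∫ τ in (0 : ℝ)..1,
      (schwarzian Ψ (φ.lift τ - θ) + 2 * a * deriv Ψ (φ.lift τ - θ) ^ 2)
        * deriv φ.lift τ ^ 2)) ∂μ 0 := by
  have hs := hΨ.comp_sub_const θ
  rw [hμ.measure_univ_eq_lintegral_postcomp a (ofLift _ hs)]
  refine lintegral_congr fun φ => ?_
  rw [← UnitAddCircle.intervalIntegral_preimage 0, zero_add]
  congr 3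
  refine intervalIntegral.integral_congr fun τ _ => ?_
  simp only [coe_lift φ, deriv_coe hs (ofLift_coe _ hs), schwarzian_coe hs (ofLift_coe _ hs),
    deriv_coe_lift, schwarzian_comp_sub_const, deriv_comp_sub_const]

end ChangeOfVariables

/-! ### Periodic approximations of the Dirac mass -/

/-- A continuous `1`-periodic probability density supported in the `ε`-neighbourhood of `ℤ`. -/
structure IsPeriodicBump (ε : ℝ) (ρ : ℝ → ℝ) : Prop where
  continuous : Continuous ρ
  periodic : Function.Periodic ρ 1
  nonneg : ∀ x, 0 ≤ ρ x
  integral_eq : ∫ x in (0 : ℝ)..1, ρ x = 1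
  support : ∀ x, ρ x ≠ 0 → ∃ n : ℤ, |x - n| < ε

/-- A normalized tent function of the distance to ℤ. Continuity of ρ is enough, because the profile
built from it gains two derivatives. -/
theorem exists_isPeriodicBump {ε : ℝ} (hε : 0 < ε) : ∃ ρ, IsPeriodicBump ε ρ := by
  let f : ℝ → ℝ := fun x => max 0 (ε - ‖(x : UnitAddCircle)‖)
  have hf : Continuous f :=
    continuous_const.max (continuous_const.sub (AddCircle.continuous_mk' 1).norm)
  have hp : Function.Periodic f 1 := fun x => by
    simp only [f, AddCircle.coe_add, AddCircle.coe_period, add_zero]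
  have h0 : ∀ x, 0 ≤ f x := fun x => le_max_left _ _
  have hI : 0 < ∫ x in (0 : ℝ)..1, f x := by
    refine intervalIntegral.integral_pos one_pos hf.continuousOn (fun x _ => h0 x)
      ⟨0, by simp, ?_⟩
    simp [f, hε]
  refine ⟨fun x => (∫ x in (0 : ℝ)..1, f x)⁻¹ * f x, continuous_const.mul hf,
    fun x => by simp only [hp x], fun x => mul_nonneg (inv_nonneg.2 hI.le) (h0 x), ?_, fun x hx => ?_⟩
  · rw [intervalIntegral.integral_const_mul, inv_mul_cancel₀ hI.ne']
  · have hx' : f x ≠ 0 := right_ne_zero_of_mul hx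
    have h1 : ‖(x : UnitAddCircle)‖ < ε := by
      by_contra h
      exact hx' (max_eq_left (by linarith))
    rw [UnitAddCircle.norm_eq] at h1
    exact ⟨round x, h1⟩

/-- An average is close to L as soon as f is, at the points charged by the probability density w.
All concentration arguments below reduce to this. -/
theorem abs_integral_mul_sub_le {w f : ℝ → ℝ} {L η : ℝ} (hw : Continuous w) (hf : Continuous f)
    (hw0 : ∀ u, 0 ≤ w u) (hw1 : ∫ u in (0 : ℝ)..1, w u = 1)
    (h : ∀ u ∈ Set.Icc (0 : ℝ) 1, w u ≠ 0 → |f u - L| ≤ η) :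
    |(∫ u in (0 : ℝ)..1, f u * w u) - L| ≤ η := by
  have e : (∫ u in (0 : ℝ)..1, f u * w u) - L = ∫ u in (0 : ℝ)..1, (f u - L) * w u := by
    simp_rw [sub_mul]
    rw [intervalIntegral.integral_sub (Continuous.intervalIntegrable (by fun_prop) _ _)
      (Continuous.intervalIntegrable (by fun_prop) _ _), intervalIntegral.integral_const_mul, hw1,
      mul_one]
  rw [e]
  calc |∫ u in (0 : ℝ)..1, (f u - L) * w u| ≤ ∫ u in (0 : ℝ)..1, |(f u - L) * w u| :=
        intervalIntegral.abs_integral_le_integral_abs zero_le_one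
    _ ≤ ∫ u in (0 : ℝ)..1, η * w u := by
        refine intervalIntegral.integral_mono_on zero_le_one
          (((hf.sub continuous_const).mul hw).abs.intervalIntegrable _ _)
          ((continuous_const.mul hw).intervalIntegrable _ _) fun u hu => ?_
        rw [abs_mul, abs_of_nonneg (hw0 u)]
        by_cases h0 : w u = 0
        · simp [h0]
        · exact mul_le_mul_of_nonneg_right (h u hu h0) (hw0 u)
    _ = η := by rw [intervalIntegral.integral_const_mul, hw1, mul_one]

namespace IsPeriodicBump

variable {ε : ℝ} {ρ : ℝ → ℝ}

theorem integral_reflect (h : IsPeriodicBump ε ρ) (x : ℝ) : ∫ u in (0 : ℝ)..1, ρ (x - u) = 1 := by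
  rw [intervalIntegral.integral_comp_sub_left ρ x, sub_zero]
  have := h.periodic.intervalIntegral_add_eq (x - 1) 0
  rw [sub_add_cancel, zero_add] at this
  rw [this, h.integral_eq]

theorem integral_comp_mul_deriv (h : IsPeriodicBump ε ρ) {Φ : ℝ → ℝ} (hΦ : IsDiffLift 1 Φ)
    (θ : ℝ) : ∫ τ in (0 : ℝ)..1, ρ (Φ τ - θ) * deriv Φ τ = 1 := by
  have h1 := intervalIntegral.integral_comp_mul_deriv (a := 0) (b := 1) (f := fun τ => Φ τ - θ)
    (f' := deriv Φ) (g := ρ) (fun x _ => (hΦ.hasDerivAt le_rfl x).sub_const θ)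
    (hΦ.continuous_deriv le_rfl).continuousOn h.continuous
  have h2 := hΦ.map_add_one 0
  rw [zero_add] at h2
  rw [h2] at h1
  refine h1.trans ?_
  have := h.periodic.intervalIntegral_add_eq (Φ 0 - θ) 0
  rw [zero_add, h.integral_eq] at this
  rw [show Φ 0 + 1 - θ = Φ 0 - θ + 1 by ring, this]

end IsPeriodicBump

/-! ### Convolution of a density with the periodic exponentials -/

/-- The convolution of `ρ` with the periodization of `u ↦ exp (m (u - 1/2))`, `0 < u < 1`. -/
noncomputable def expConv (m : ℝ) (ρ : ℝ → ℝ) (x : ℝ) : ℝ :=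
  ∫ u in (0 : ℝ)..1, Real.exp (m * (u - 1 / 2)) * ρ (x - u)

theorem expConv_eq (m : ℝ) (ρ : ℝ → ℝ) (x : ℝ) :
    expConv m ρ x = Real.exp (m * (x - 1 / 2)) * ∫ t in (x - 1)..x, Real.exp (-m * t) * ρ t := by
  have h := intervalIntegral.integral_comp_sub_left (a := 0) (b := 1)
    (fun t => Real.exp (m * (x - t - 1 / 2)) * ρ t) x
  rw [sub_zero] at h
  rw [← intervalIntegral.integral_const_mul, expConv]
  simp only [sub_sub_cancel] at h
  rw [h]
  refine intervalIntegral.integral_congr fun t _ => ?_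
  simp only [← mul_assoc, ← Real.exp_add]
  congr 2
  ring

/-- The periodized exponential solves f' = mf away from ℤ and jumps there by exp(-m/2) - exp(m/2);
convolution turns the jump into a multiple of ρ. -/
theorem hasDerivAt_expConv (m : ℝ) {ρ : ℝ → ℝ} (hρ : Continuous ρ) (hp : Function.Periodic ρ 1)
    (x : ℝ) : HasDerivAt (expConv m ρ)
      (m * expConv m ρ x + (Real.exp (-(m / 2)) - Real.exp (m / 2)) * ρ x) x := by
  let f : ℝ → ℝ := fun t => Real.exp (-m * t) * ρ t
  have hf : Continuous f := by fun_prop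
  have hi : ∀ a b, IntervalIntegrable f volume a b := fun a b => hf.intervalIntegrable a b
  have hF : ∀ x, HasDerivAt (fun x => ∫ t in (0 : ℝ)..x, f t) (f x) x := fun x =>
    intervalIntegral.integral_hasDerivAt_right (hi _ _)
      hf.stronglyMeasurable.stronglyMeasurableAtFilter hf.continuousAt
  have hI : HasDerivAt (fun x => ∫ t in (x - 1)..x, f t) (f x - f (x - 1)) x := by
    have : (fun x => ∫ t in (x - 1)..x, f t)
        = fun x => (∫ t in (0 : ℝ)..x, f t) - ∫ t in (0 : ℝ)..(x - 1), f t :=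
      funext fun x => (intervalIntegral.integral_interval_sub_left (hi _ _) (hi _ _)).symm
    rw [this]
    exact (hF x).sub ((hF (x - 1)).comp_sub_const x 1)
  have hE : HasDerivAt (fun x => Real.exp (m * (x - 1 / 2))) (Real.exp (m * (x - 1 / 2)) * m) x := by
    have := (((hasDerivAt_id x).sub_const (1 / 2)).const_mul m).exp
    simpa using this
  have h := hE.mul hI
  have e : expConv m ρ = fun x => Real.exp (m * (x - 1 / 2)) * ∫ t in (x - 1)..x, f t :=
    funext fun x => expConv_eq m ρ x
  have hρ1 : ρ (x - 1) = ρ x := by rw [← hp (x - 1), sub_add_cancel]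
  rw [e]
  refine h.congr_deriv ?_
  simp only [f, hρ1]
  have e1 : Real.exp (m * (x - 1 / 2)) * Real.exp (-m * x) = Real.exp (-(m / 2)) := by
    rw [← Real.exp_add]; congr 1; ring
  have e2 : Real.exp (m * (x - 1 / 2)) * Real.exp (-m * (x - 1)) = Real.exp (m / 2) := by
    rw [← Real.exp_add]; congr 1; ring
  linear_combination ρ x * e1 - ρ x * e2

/-- The Cauchy–Schwarz inequality for a function and its reciprocal, obtained by averaging q + 1/q ≥
2 and then optimizing the scaling a. -/
theorem one_le_expConv_mul_expConv (m : ℝ) {ε : ℝ} {ρ : ℝ → ℝ} (h : IsPeriodicBump ε ρ) (x : ℝ) :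
    0 < expConv m ρ x ∧ 1 ≤ expConv m ρ x * expConv (-m) ρ x := by
  have hc : Continuous ρ := h.continuous
  have hlow : ∀ n : ℝ, ∀ a : ℝ, 0 < a →
      2 ≤ a * expConv n ρ x + a⁻¹ * expConv (-n) ρ x := by
    intro n a ha
    rw [expConv, expConv, ← intervalIntegral.integral_const_mul,
      ← intervalIntegral.integral_const_mul, ← intervalIntegral.integral_add
      (Continuous.intervalIntegrable (by fun_prop) _ _)
      (Continuous.intervalIntegrable (by fun_prop) _ _)]
    have e : (2 : ℝ) = ∫ u in (0 : ℝ)..1, 2 * ρ (x - u) := by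
      rw [intervalIntegral.integral_const_mul, h.integral_reflect, mul_one]
    refine e.trans_le ?_
    refine intervalIntegral.integral_mono_on zero_le_one
      (Continuous.intervalIntegrable (by fun_prop) _ _)
      (Continuous.intervalIntegrable (by fun_prop) _ _) fun u _ => ?_
    have e1 : Real.exp (-n * (u - 1 / 2)) = (Real.exp (n * (u - 1 / 2)))⁻¹ := by
      rw [← Real.exp_neg]; congr 1; ring
    rw [e1, ← mul_assoc, ← mul_assoc, ← add_mul, ← mul_inv]
    refine mul_le_mul_of_nonneg_right ?_ (h.nonneg _)
    have hp : 0 < a * Real.exp (n * (u - 1 / 2)) := mul_pos ha (Real.exp_pos _)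
    set q := a * Real.exp (n * (u - 1 / 2))
    have : q + q⁻¹ - 2 = (q - 1) ^ 2 / q := by field_simp; ring
    have : 0 ≤ (q - 1) ^ 2 / q := by positivity
    linarith
  have hpos : 0 < expConv m ρ x := by
    have hmin : ∀ u ∈ Set.Icc (0 : ℝ) 1, Real.exp (-|m|) ≤ Real.exp (m * (u - 1 / 2)) := by
      intro u hu
      refine Real.exp_le_exp.2 ?_
      have : |m * (u - 1 / 2)| ≤ |m| := by
        rw [abs_mul]
        refine mul_le_of_le_one_right (abs_nonneg m) (abs_le.2 ⟨?_, ?_⟩) <;>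
          linarith [hu.1, hu.2]
      linarith [neg_abs_le (m * (u - 1 / 2))]
    have : Real.exp (-|m|) ≤ expConv m ρ x := by
      calc Real.exp (-|m|) = ∫ u in (0 : ℝ)..1, Real.exp (-|m|) * ρ (x - u) := by
            rw [intervalIntegral.integral_const_mul, h.integral_reflect, mul_one]
        _ ≤ _ := intervalIntegral.integral_mono_on zero_le_one
            (Continuous.intervalIntegrable (by fun_prop) _ _)
            (Continuous.intervalIntegrable (by fun_prop) _ _) fun u hu =>
            mul_le_mul_of_nonneg_right (hmin u hu) (h.nonneg _)
    exact (Real.exp_pos _).trans_le this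
  refine ⟨hpos, ?_⟩
  -- Taking a to be the reciprocal of the first average makes the first summand 1, leaving 1 for the
  -- product.
  have := hlow m _ (inv_pos.2 hpos)
  rw [inv_mul_cancel₀ hpos.ne', inv_inv] at this
  linarith

/-- The convolution of `ρ` with the periodization of `u ↦ cosh (2 b (u - 1/2))`, `0 < u < 1`. -/
noncomputable def coshConv (b : ℝ) (ρ : ℝ → ℝ) (x : ℝ) : ℝ :=
  ∫ u in (0 : ℝ)..1, Real.cosh (2 * b * (u - 1 / 2)) * ρ (x - u)

/-- The convolution of `ρ` with the periodization of `u ↦ sinh (2 b (u - 1/2))`, `0 < u < 1`. -/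
noncomputable def sinhConv (b : ℝ) (ρ : ℝ → ℝ) (x : ℝ) : ℝ :=
  ∫ u in (0 : ℝ)..1, Real.sinh (2 * b * (u - 1 / 2)) * ρ (x - u)

section Conv

variable {b ε : ℝ} {ρ : ℝ → ℝ}

theorem coshConv_eq_expConv (hρ : Continuous ρ) (x : ℝ) :
    coshConv b ρ x = (expConv (2 * b) ρ x + expConv (-(2 * b)) ρ x) / 2 := by
  rw [coshConv, expConv, expConv, ← intervalIntegral.integral_add
      (Continuous.intervalIntegrable (by fun_prop) _ _)
      (Continuous.intervalIntegrable (by fun_prop) _ _), ← intervalIntegral.integral_div]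
  refine intervalIntegral.integral_congr fun u _ => ?_
  simp only [Real.cosh_eq, neg_mul]
  ring

theorem sinhConv_eq_expConv (hρ : Continuous ρ) (x : ℝ) :
    sinhConv b ρ x = (expConv (2 * b) ρ x - expConv (-(2 * b)) ρ x) / 2 := by
  rw [sinhConv, expConv, expConv, ← intervalIntegral.integral_sub
      (Continuous.intervalIntegrable (by fun_prop) _ _)
      (Continuous.intervalIntegrable (by fun_prop) _ _), ← intervalIntegral.integral_div]
  refine intervalIntegral.integral_congr fun u _ => ?_
  simp only [Real.sinh_eq, neg_mul]
  ring

/-- No ρ appears: cosh is even, so its kernel has equal values at the two ends of the period and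
does not jump. The sinh kernel does jump, by -2 sinh b. -/
theorem hasDerivAt_coshConv (h : IsPeriodicBump ε ρ) (x : ℝ) :
    HasDerivAt (coshConv b ρ) (2 * b * sinhConv b ρ x) x := by
  have e : coshConv b ρ = fun x => (expConv (2 * b) ρ x + expConv (-(2 * b)) ρ x) / 2 :=
    funext fun x => coshConv_eq_expConv h.continuous x
  have h1 := hasDerivAt_expConv (2 * b) h.continuous h.periodic x
  have h2 := hasDerivAt_expConv (-(2 * b)) h.continuous h.periodic x
  rw [e, sinhConv_eq_expConv h.continuous]
  refine ((h1.add h2).div_const 2).congr_deriv ?_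
  rw [show -(2 * b) / 2 = -(2 * b / 2) by ring, neg_neg]
  ring

theorem hasDerivAt_sinhConv (h : IsPeriodicBump ε ρ) (x : ℝ) :
    HasDerivAt (sinhConv b ρ) (2 * b * coshConv b ρ x - 2 * Real.sinh b * ρ x) x := by
  have e : sinhConv b ρ = fun x => (expConv (2 * b) ρ x - expConv (-(2 * b)) ρ x) / 2 :=
    funext fun x => sinhConv_eq_expConv h.continuous x
  have h1 := hasDerivAt_expConv (2 * b) h.continuous h.periodic x
  have h2 := hasDerivAt_expConv (-(2 * b)) h.continuous h.periodic x
  rw [e, coshConv_eq_expConv h.continuous]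
  refine ((h1.sub h2).div_const 2).congr_deriv ?_
  rw [show -(2 * b) / 2 = -(2 * b / 2) by ring, neg_neg, Real.sinh_eq,
    show 2 * b / 2 = b by ring]
  ring

/-- What survives of cosh² - sinh² = 1 after averaging. The inequality has the direction needed to
bound the potential from above. -/
theorem sinhConv_sq_add_one_le (h : IsPeriodicBump ε ρ) (x : ℝ) :
    sinhConv b ρ x ^ 2 + 1 ≤ coshConv b ρ x ^ 2 := by
  have := (one_le_expConv_mul_expConv (2 * b) h x).2
  rw [sinhConv_eq_expConv h.continuous, coshConv_eq_expConv h.continuous]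
  nlinarith

theorem one_le_coshConv (h : IsPeriodicBump ε ρ) (x : ℝ) : 1 ≤ coshConv b ρ x := by
  have h1 := (one_le_expConv_mul_expConv (2 * b) h x).1
  have h2 := (one_le_expConv_mul_expConv (-(2 * b)) h x).1
  have h3 := sinhConv_sq_add_one_le (b := b) h x
  have h4 : 0 < coshConv b ρ x := by
    rw [coshConv_eq_expConv h.continuous]; linarith
  nlinarith [sq_nonneg (sinhConv b ρ x)]

theorem coshConv_le (hb : 0 ≤ b) (h : IsPeriodicBump ε ρ) (x : ℝ) :
    coshConv b ρ x ≤ Real.cosh b := by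
  have hc : Continuous ρ := h.continuous
  calc coshConv b ρ x ≤ ∫ u in (0 : ℝ)..1, Real.cosh b * ρ (x - u) := by
        refine intervalIntegral.integral_mono_on zero_le_one
            (Continuous.intervalIntegrable (by fun_prop) _ _)
            (Continuous.intervalIntegrable (by fun_prop) _ _) fun u hu =>
            mul_le_mul_of_nonneg_right ?_ (h.nonneg _)
        rw [Real.cosh_le_cosh, abs_of_nonneg hb, abs_le]
        constructor <;> nlinarith [hu.1, hu.2]
    _ = Real.cosh b := by rw [intervalIntegral.integral_const_mul, h.integral_reflect, mul_one]

theorem coshConv_periodic (h : Function.Periodic ρ 1) : Function.Periodic (coshConv b ρ) 1 := by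
  intro x
  simp only [coshConv, add_sub_right_comm, h _]

/-- For non-integral x the fractional part is interior to [0, 1], so the weight concentrates at this
single point and never sees the endpoints, where the periodized f may jump. -/
theorem tendsto_integral_mul_bump {f : ℝ → ℝ} (hf : Continuous f) {ρ : ℕ → ℝ → ℝ}
    {ε : ℕ → ℝ} (hε : Tendsto ε atTop (𝓝 0)) (hρ : ∀ n, IsPeriodicBump (ε n) (ρ n)) {x : ℝ}
    (hx : ∀ n : ℤ, x ≠ n) :
    Tendsto (fun n => ∫ u in (0 : ℝ)..1, f u * ρ n (x - u)) atTop (𝓝 (f (Int.fract x))) := by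
  have h0 : 0 < Int.fract x := (Int.fract_nonneg x).lt_of_ne fun h => by
    have := Int.self_sub_fract x
    rw [← h, sub_zero] at this
    exact hx _ this
  have h1 := Int.fract_lt_one x
  rw [Metric.tendsto_atTop']
  intro η hη
  obtain ⟨δ, hδ, hfδ⟩ := Metric.continuousAt_iff.1 (hf.continuousAt (x := Int.fract x)) (η / 2)
    (half_pos hη)
  have hm : 0 < min δ (min (Int.fract x) (1 - Int.fract x)) :=
    lt_min hδ (lt_min h0 (by linarith))
  obtain ⟨N, hN⟩ := eventually_atTop.1 (hε.eventually_lt_const hm)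
  refine ⟨N, fun n hn => ?_⟩
  have hn' := hN n hn.le
  rw [lt_min_iff, lt_min_iff] at hn'
  rw [Real.dist_eq]
  refine lt_of_le_of_lt (abs_integral_mul_sub_le ((hρ n).continuous.comp (by fun_prop)) hf
    (fun u => (hρ n).nonneg _) ((hρ n).integral_reflect x) fun u hu hne => ?_) (half_lt_self hη)
  obtain ⟨m, hmm⟩ := (hρ n).support _ hne
  have key : |Int.fract x - u - ((m - ⌊x⌋ : ℤ) : ℝ)| < ε n := by
    convert hmm using 2
    push_cast
    rw [← Int.self_sub_floor]
    ring
  set j : ℤ := m - ⌊x⌋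
  rw [abs_lt] at key
  have hj : j = 0 := by
    have a1 : (j : ℝ) < 1 := by linarith [hu.1, hu.2]
    have a2 : (-1 : ℝ) < j := by linarith [hu.1, hu.2]
    have a1' : j < 1 := by exact_mod_cast a1
    have a2' : -1 < j := by exact_mod_cast a2
    omega
  rw [hj] at key
  have := hfδ (x := u) (by rw [Real.dist_eq, abs_lt]; push_cast at key; constructor <;> linarith)
  rw [Real.dist_eq] at this
  exact this.le

end Conv

/-! ### Smoothed diffeomorphisms with a kink at `0` -/

/-- The reciprocal, up to normalization, of the derivative of `kinkLift`. -/
noncomputable def kinkProfile (b k : ℝ) (ρ : ℝ → ℝ) (x : ℝ) : ℝ := 1 + k - k * coshConv b ρ x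

/-- The constant that makes `kinkNorm / kinkProfile` a probability density on the circle. -/
noncomputable def kinkNorm (b k : ℝ) (ρ : ℝ → ℝ) : ℝ :=
  (∫ x in (0 : ℝ)..1, (kinkProfile b k ρ x)⁻¹)⁻¹

/-- A lift of a circle diffeomorphism whose second derivative is concentrated on the support
of `ρ`, up to a part of constant projective curvature. -/
noncomputable def kinkLift (b k : ℝ) (ρ : ℝ → ℝ) (x : ℝ) : ℝ :=
  ∫ t in (0 : ℝ)..x, kinkNorm b k ρ * (kinkProfile b k ρ t)⁻¹

section Kink

variable {b k ε : ℝ} {ρ : ℝ → ℝ}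

theorem le_kinkProfile (hb : 0 ≤ b) (hk : 0 ≤ k) (h : IsPeriodicBump ε ρ) (x : ℝ) :
    1 + k - k * Real.cosh b ≤ kinkProfile b k ρ x := by
  have := mul_le_mul_of_nonneg_left (coshConv_le hb h x) hk
  rw [kinkProfile]
  linarith

theorem kinkProfile_le_one (hk : 0 ≤ k) (h : IsPeriodicBump ε ρ) (x : ℝ) :
    kinkProfile b k ρ x ≤ 1 := by
  have := mul_le_mul_of_nonneg_left (one_le_coshConv (b := b) h x) hk
  rw [kinkProfile]
  linarith

theorem hasDerivAt_kinkProfile (h : IsPeriodicBump ε ρ) (x : ℝ) :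
    HasDerivAt (kinkProfile b k ρ) (-(2 * k * b * sinhConv b ρ x)) x :=
  (((hasDerivAt_coshConv h x).const_mul k).const_sub (1 + k)).congr_deriv (by ring)

theorem contDiff_kinkProfile (h : IsPeriodicBump ε ρ) : ContDiff ℝ 2 (kinkProfile b k ρ) := by
  have hs : ContDiff ℝ 1 (sinhConv b ρ) := by
    rw [contDiff_one_iff_deriv]
    refine ⟨fun x => (hasDerivAt_sinhConv h x).differentiableAt, ?_⟩
    have : deriv (sinhConv b ρ) = fun x => 2 * b * coshConv b ρ x - 2 * Real.sinh b * ρ x :=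
      funext fun x => (hasDerivAt_sinhConv h x).deriv
    rw [this]
    have hc : Continuous (coshConv b ρ) :=
      continuous_iff_continuousAt.2 fun x => (hasDerivAt_coshConv h x).continuousAt
    exact (continuous_const.mul hc).sub (continuous_const.mul h.continuous)
  rw [show (2 : WithTop ℕ∞) = 1 + 1 by norm_num, contDiff_succ_iff_deriv]
  refine ⟨fun x => (hasDerivAt_kinkProfile h x).differentiableAt, by simp, ?_⟩
  have : deriv (kinkProfile b k ρ) = fun x => -(2 * k * b * sinhConv b ρ x) :=
    funext fun x => (hasDerivAt_kinkProfile h x).deriv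
  rw [this]
  exact (contDiff_const.mul hs).neg

theorem kinkProfile_pos (hb : 0 ≤ b) (hk : 0 ≤ k) (hpos : 0 < 1 + k - k * Real.cosh b)
    (h : IsPeriodicBump ε ρ) (x : ℝ) : 0 < kinkProfile b k ρ x :=
  hpos.trans_le (le_kinkProfile hb hk h x)

theorem continuous_inv_kinkProfile (hb : 0 ≤ b) (hk : 0 ≤ k)
    (hpos : 0 < 1 + k - k * Real.cosh b) (h : IsPeriodicBump ε ρ) :
    Continuous fun x => (kinkProfile b k ρ x)⁻¹ :=
  (contDiff_kinkProfile h).continuous.inv₀ fun x => (kinkProfile_pos hb hk hpos h x).ne'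

theorem one_le_integral_inv_kinkProfile (hb : 0 ≤ b) (hk : 0 ≤ k)
    (hpos : 0 < 1 + k - k * Real.cosh b) (h : IsPeriodicBump ε ρ) :
    1 ≤ ∫ x in (0 : ℝ)..1, (kinkProfile b k ρ x)⁻¹ := by
  have := intervalIntegral.integral_mono_on (a := 0) (b := 1) (μ := volume)
    (f := fun _ => (1 : ℝ)) zero_le_one (continuous_const.intervalIntegrable _ _)
    ((continuous_inv_kinkProfile hb hk hpos h).intervalIntegrable _ _)
    fun x _ => (one_le_inv₀ (kinkProfile_pos hb hk hpos h x)).2 (kinkProfile_le_one hk h x)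
  simpa using this

theorem kinkNorm_pos (hb : 0 ≤ b) (hk : 0 ≤ k) (hpos : 0 < 1 + k - k * Real.cosh b)
    (h : IsPeriodicBump ε ρ) : 0 < kinkNorm b k ρ :=
  inv_pos.2 (one_pos.trans_le (one_le_integral_inv_kinkProfile hb hk hpos h))

theorem kinkNorm_le_one (hb : 0 ≤ b) (hk : 0 ≤ k) (hpos : 0 < 1 + k - k * Real.cosh b)
    (h : IsPeriodicBump ε ρ) : kinkNorm b k ρ ≤ 1 :=
  inv_le_one_of_one_le₀ (one_le_integral_inv_kinkProfile hb hk hpos h)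

theorem hasDerivAt_kinkLift (hb : 0 ≤ b) (hk : 0 ≤ k) (hpos : 0 < 1 + k - k * Real.cosh b)
    (h : IsPeriodicBump ε ρ) (x : ℝ) :
    HasDerivAt (kinkLift b k ρ) (kinkNorm b k ρ * (kinkProfile b k ρ x)⁻¹) x := by
  have hc : Continuous fun t => kinkNorm b k ρ * (kinkProfile b k ρ t)⁻¹ :=
    continuous_const.mul (continuous_inv_kinkProfile hb hk hpos h)
  exact intervalIntegral.integral_hasDerivAt_right (hc.intervalIntegrable _ _)
      hc.stronglyMeasurable.stronglyMeasurableAtFilter hc.continuousAt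

theorem isDiffLift_kinkLift (hb : 0 ≤ b) (hk : 0 ≤ k) (hpos : 0 < 1 + k - k * Real.cosh b)
    (h : IsPeriodicBump ε ρ) : IsDiffLift 3 (kinkLift b k ρ) := by
  have hd : deriv (kinkLift b k ρ) = fun x => kinkNorm b k ρ * (kinkProfile b k ρ x)⁻¹ :=
    funext fun x => (hasDerivAt_kinkLift hb hk hpos h x).deriv
  have hc : Continuous fun t => kinkNorm b k ρ * (kinkProfile b k ρ t)⁻¹ :=
    continuous_const.mul (continuous_inv_kinkProfile hb hk hpos h)
  refine ⟨?_, fun x => ?_, fun x => ?_⟩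
  · rw [show ((3 : ℕ) : WithTop ℕ∞) = 2 + 1 by norm_num, contDiff_succ_iff_deriv]
    refine ⟨fun x => (hasDerivAt_kinkLift hb hk hpos h x).differentiableAt, by simp, ?_⟩
    rw [hd]
    exact contDiff_const.mul
      ((contDiff_kinkProfile h).inv fun x => (kinkProfile_pos hb hk hpos h x).ne')
  · rw [hd]
    exact mul_pos (kinkNorm_pos hb hk hpos h) (inv_pos.2 (kinkProfile_pos hb hk hpos h x))
  · have hper : Function.Periodic (fun t => kinkNorm b k ρ * (kinkProfile b k ρ t)⁻¹) 1 := by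
      intro x
      simp only [kinkProfile, coshConv_periodic h.periodic x]
    have h1 := hper.intervalIntegral_add_eq x 0
    rw [zero_add] at h1
    have h2 : kinkNorm b k ρ * ∫ x in (0 : ℝ)..1, (kinkProfile b k ρ x)⁻¹ = 1 :=
      inv_mul_cancel₀ (one_pos.trans_le (one_le_integral_inv_kinkProfile hb hk hpos h)).ne'
    rw [← intervalIntegral.integral_const_mul] at h2
    rw [kinkLift, kinkLift, ← intervalIntegral.integral_add_adjacent_intervals
      (hc.intervalIntegrable 0 x) (hc.intervalIntegrable x (x + 1)), h1, h2]

/-- When the derivative of the lift is N/y, its Schwarzian is -y''/y + y'²/(2y²). The bump ρ enters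
only through y''. -/
theorem schwarzian_kinkLift (hb : 0 ≤ b) (hk : 0 ≤ k) (hpos : 0 < 1 + k - k * Real.cosh b)
    (h : IsPeriodicBump ε ρ) (x : ℝ) :
    schwarzian (kinkLift b k ρ) x
      = (4 * k * b ^ 2 * coshConv b ρ x * kinkProfile b k ρ x
          + 2 * (k * b * sinhConv b ρ x) ^ 2) / kinkProfile b k ρ x ^ 2
        - 4 * k * b * Real.sinh b * (ρ x / kinkProfile b k ρ x) := by
  have hy := fun x => (kinkProfile_pos hb hk hpos h x).ne'
  have hn := (kinkNorm_pos hb hk hpos h).ne'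
  have hd : deriv (kinkLift b k ρ) = fun x => kinkNorm b k ρ * (kinkProfile b k ρ x)⁻¹ :=
    funext fun x => (hasDerivAt_kinkLift hb hk hpos h x).deriv
  have hd2 : deriv (fun x => kinkNorm b k ρ * (kinkProfile b k ρ x)⁻¹)
      = fun x => kinkNorm b k ρ * (2 * k * b * sinhConv b ρ x / kinkProfile b k ρ x ^ 2) :=
    funext fun x => by
      refine (((hasDerivAt_kinkProfile h x).inv (hy x)).const_mul (kinkNorm b k ρ)).deriv.trans ?_
      ring
  have hq : (fun x => kinkNorm b k ρ * (2 * k * b * sinhConv b ρ x / kinkProfile b k ρ x ^ 2)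
      / (kinkNorm b k ρ * (kinkProfile b k ρ x)⁻¹))
      = fun x => 2 * k * b * sinhConv b ρ x / kinkProfile b k ρ x := funext fun x => by
    have := hy x
    field_simp
  have hq' : deriv (fun x => 2 * k * b * sinhConv b ρ x / kinkProfile b k ρ x) x = _ :=
    (((hasDerivAt_sinhConv h x).const_mul (2 * k * b)).div
      (hasDerivAt_kinkProfile (b := b) (k := k) h x) (hy x)).deriv
  have hqx := congrFun hq x
  beta_reduce at hqx
  rw [schwarzian, hd, hd2, hq, hqx, hq']
  have := hy x
  field_simp
  ring

/-- The regular part of the potential of `kinkLift`. -/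
noncomputable def kinkReg (b k l : ℝ) (ρ : ℝ → ℝ) (x : ℝ) : ℝ :=
  (4 * k * b ^ 2 * coshConv b ρ x * kinkProfile b k ρ x + 2 * (k * b * sinhConv b ρ x) ^ 2
    - 2 * (l * kinkNorm b k ρ) ^ 2) / kinkProfile b k ρ x ^ 2

theorem potential_kinkLift (hb : 0 ≤ b) (hk : 0 ≤ k) (hpos : 0 < 1 + k - k * Real.cosh b)
    (h : IsPeriodicBump ε ρ) (l x : ℝ) :
    schwarzian (kinkLift b k ρ) x + 2 * (-l ^ 2) * deriv (kinkLift b k ρ) x ^ 2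
      = kinkReg b k l ρ x - 4 * k * b * Real.sinh b * (ρ x / kinkProfile b k ρ x) := by
  rw [schwarzian_kinkLift hb hk hpos h, (hasDerivAt_kinkLift hb hk hpos h x).deriv, kinkReg]
  have := (kinkProfile_pos hb hk hpos h x).ne'
  field_simp
  ring

/-- If (lN)² = (1 + 2k)b² and cosh² - sinh² = 1 held for the convolutions, the regular part would be
exactly -2b². Smoothing breaks the second identity with a favourable sign, so only the error in the
first remains. The bound is uniform in x, as domination over all φ demands. -/
theorem kinkReg_le (hb : 0 ≤ b) (hk : 0 ≤ k) (hpos : 0 < 1 + k - k * Real.cosh b)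
    (h : IsPeriodicBump ε ρ) (l x : ℝ) :
    kinkReg b k l ρ x ≤ -2 * b ^ 2
      + 2 * |(1 + 2 * k) * b ^ 2 - (l * kinkNorm b k ρ) ^ 2| / (1 + k - k * Real.cosh b) ^ 2 := by
  have hy := kinkProfile_pos hb hk hpos h x
  have h1 : kinkReg b k l ρ x ≤ -2 * b ^ 2
      + 2 * ((1 + 2 * k) * b ^ 2 - (l * kinkNorm b k ρ) ^ 2) / kinkProfile b k ρ x ^ 2 := by
    rw [kinkReg, ← sub_nonneg]
    have e : -2 * b ^ 2
      + 2 * ((1 + 2 * k) * b ^ 2 - (l * kinkNorm b k ρ) ^ 2) / kinkProfile b k ρ x ^ 2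
      - (4 * k * b ^ 2 * coshConv b ρ x * kinkProfile b k ρ x + 2 * (k * b * sinhConv b ρ x) ^ 2
    - 2 * (l * kinkNorm b k ρ) ^ 2) / kinkProfile b k ρ x ^ 2
      = 2 * (k * b) ^ 2 * (coshConv b ρ x ^ 2 - (sinhConv b ρ x ^ 2 + 1))
        / kinkProfile b k ρ x ^ 2 := by
      have hy' := hy.ne'
      field_simp
      simp only [kinkProfile]
      ring
    rw [e]
    have := sub_nonneg.2 (sinhConv_sq_add_one_le (b := b) h x)
    positivity
  refine h1.trans (add_le_add_right ?_ _)
  have h2 := le_kinkProfile hb hk h x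
  calc _ ≤ 2 * |(1 + 2 * k) * b ^ 2 - (l * kinkNorm b k ρ) ^ 2| / kinkProfile b k ρ x ^ 2 := by
        gcongr
        exact le_abs_self _
    _ ≤ _ := by gcongr

/-- A crude two-sided bound independent of ρ, for dominated convergence along a fixed φ. -/
theorem abs_kinkReg_le (hb : 0 ≤ b) (hk : 0 ≤ k) (hpos : 0 < 1 + k - k * Real.cosh b)
    (h : IsPeriodicBump ε ρ) (l x : ℝ) :
    |kinkReg b k l ρ x| ≤ (4 * k * b ^ 2 * Real.cosh b + 2 * (k * b) ^ 2 * Real.cosh b ^ 2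
      + 2 * l ^ 2) / (1 + k - k * Real.cosh b) ^ 2 := by
  have hy := kinkProfile_pos hb hk hpos h x
  have h2 := le_kinkProfile hb hk h x
  have h3 := coshConv_le hb h x
  have h4 := one_le_coshConv (b := b) h x
  have h5 := sinhConv_sq_add_one_le (b := b) h x
  have h6 := kinkProfile_le_one (b := b) hk h x
  have h7 := kinkNorm_le_one hb hk hpos h
  have h8 := kinkNorm_pos hb hk hpos h
  have hnum : |4 * k * b ^ 2 * coshConv b ρ x * kinkProfile b k ρ x
      + 2 * (k * b * sinhConv b ρ x) ^ 2 - 2 * (l * kinkNorm b k ρ) ^ 2|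
      ≤ 4 * k * b ^ 2 * Real.cosh b + 2 * (k * b) ^ 2 * Real.cosh b ^ 2 + 2 * l ^ 2 := by
    have a1 : 0 ≤ 4 * k * b ^ 2 * coshConv b ρ x * kinkProfile b k ρ x := by positivity
    have a2 : 4 * k * b ^ 2 * coshConv b ρ x * kinkProfile b k ρ x
        ≤ 4 * k * b ^ 2 * Real.cosh b * 1 := by gcongr
    have a3 : 2 * (k * b * sinhConv b ρ x) ^ 2 ≤ 2 * (k * b) ^ 2 * Real.cosh b ^ 2 := by
      rw [mul_pow, ← mul_assoc]
      have : sinhConv b ρ x ^ 2 ≤ Real.cosh b ^ 2 := by nlinarith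
      gcongr
    have a4 : 0 ≤ 2 * (k * b * sinhConv b ρ x) ^ 2 := by positivity
    have a5 : 2 * (l * kinkNorm b k ρ) ^ 2 ≤ 2 * l ^ 2 := by
      rw [mul_pow]
      have : kinkNorm b k ρ ^ 2 ≤ 1 := by nlinarith
      nlinarith [sq_nonneg l]
    have a6 : 0 ≤ 2 * (l * kinkNorm b k ρ) ^ 2 := by positivity
    rw [abs_le]
    constructor <;> linarith
  rw [kinkReg, abs_div, abs_of_nonneg (sq_nonneg (kinkProfile b k ρ x))]
  gcongr

theorem continuous_kinkReg (hb : 0 ≤ b) (hk : 0 ≤ k) (hpos : 0 < 1 + k - k * Real.cosh b)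
    (h : IsPeriodicBump ε ρ) (l : ℝ) : Continuous (kinkReg b k l ρ) := by
  have hc : Continuous (coshConv b ρ) :=
    continuous_iff_continuousAt.2 fun x => (hasDerivAt_coshConv h x).continuousAt
  have hs : Continuous (sinhConv b ρ) :=
    continuous_iff_continuousAt.2 fun x => (hasDerivAt_sinhConv h x).continuousAt
  have hy : Continuous (kinkProfile b k ρ) := (contDiff_kinkProfile h).continuous
  unfold kinkReg
  exact Continuous.div (by fun_prop) (by fun_prop)
    fun x => pow_ne_zero _ (kinkProfile_pos hb hk hpos h x).ne'

end Kink

/-! ### The limit of vanishing smoothing -/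

section KinkLimit

variable {b k : ℝ} {ρ : ℕ → ℝ → ℝ} {ε : ℕ → ℝ}

theorem tendsto_coshConv (hε : Tendsto ε atTop (𝓝 0)) (hρ : ∀ n, IsPeriodicBump (ε n) (ρ n))
    {x : ℝ} (hx : ∀ n : ℤ, x ≠ n) : Tendsto (fun n => coshConv b (ρ n) x) atTop
      (𝓝 (Real.cosh (2 * b * (Int.fract x - 1 / 2)))) :=
  tendsto_integral_mul_bump (f := fun u => Real.cosh (2 * b * (u - 1 / 2))) (by fun_prop) hε hρ hx

theorem tendsto_sinhConv (hε : Tendsto ε atTop (𝓝 0)) (hρ : ∀ n, IsPeriodicBump (ε n) (ρ n))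
    {x : ℝ} (hx : ∀ n : ℤ, x ≠ n) : Tendsto (fun n => sinhConv b (ρ n) x) atTop
      (𝓝 (Real.sinh (2 * b * (Int.fract x - 1 / 2)))) :=
  tendsto_integral_mul_bump (f := fun u => Real.sinh (2 * b * (u - 1 / 2))) (by fun_prop) hε hρ hx

theorem cosh_two_mul_sub_half_le (hb : 0 ≤ b) {u : ℝ} (hu : u ∈ Set.Icc (0 : ℝ) 1) :
    Real.cosh (2 * b * (u - 1 / 2)) ≤ Real.cosh b := by
  rw [Real.cosh_le_cosh, abs_of_nonneg hb, abs_le]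
  constructor <;> nlinarith [hu.1, hu.2]

theorem limitProfile_pos (hb : 0 ≤ b) (hk : 0 ≤ k) (hpos : 0 < 1 + k - k * Real.cosh b) {u : ℝ}
    (hu : u ∈ Set.Icc (0 : ℝ) 1) : 0 < 1 + k - k * Real.cosh (2 * b * (u - 1 / 2)) := by
  have := mul_le_mul_of_nonneg_left (cosh_two_mul_sub_half_le hb hu) hk
  linarith

theorem fract_mem_Icc (x : ℝ) : Int.fract x ∈ Set.Icc (0 : ℝ) 1 :=
  ⟨Int.fract_nonneg x, (Int.fract_lt_one x).le⟩

theorem tendsto_kinkNorm (hb : 0 ≤ b) (hk : 0 ≤ k) (hpos : 0 < 1 + k - k * Real.cosh b)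
    (hε : Tendsto ε atTop (𝓝 0)) (hρ : ∀ n, IsPeriodicBump (ε n) (ρ n))
    (hI : (∫ u in (0 : ℝ)..1, (1 + k - k * Real.cosh (2 * b * (u - 1 / 2)))⁻¹) ≠ 0) :
    Tendsto (fun n => kinkNorm b k (ρ n)) atTop
      (𝓝 (∫ u in (0 : ℝ)..1, (1 + k - k * Real.cosh (2 * b * (u - 1 / 2)))⁻¹)⁻¹) := by
  refine Tendsto.inv₀ ?_ hI
  refine intervalIntegral.tendsto_integral_filter_of_dominated_convergence
    (fun _ => (1 + k - k * Real.cosh b)⁻¹)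
    (Eventually.of_forall fun n =>
      (continuous_inv_kinkProfile hb hk hpos (hρ n)).aestronglyMeasurable)
    (Eventually.of_forall fun n => Eventually.of_forall fun x _ => ?_)
    (continuous_const.intervalIntegrable _ _) ?_
  · rw [Real.norm_eq_abs, abs_of_pos (inv_pos.2 (kinkProfile_pos hb hk hpos (hρ n) x))]
    exact inv_anti₀ hpos (le_kinkProfile hb hk (hρ n) x)
  · have h1 : ∀ᵐ x : ℝ, x ≠ 1 := by simp [ae_iff, measure_singleton]
    filter_upwards [h1] with x hx1 hx
    rw [Set.uIoc_of_le zero_le_one] at hx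
    have hx' : x ∈ Set.Ico (0 : ℝ) 1 := ⟨hx.1.le, lt_of_le_of_ne hx.2 hx1⟩
    have hf : Int.fract x = x := Int.fract_eq_self.2 hx'
    have hne : ∀ n : ℤ, x ≠ n := fun n hn => by
      rw [hn, Int.fract_intCast] at hf
      have := hx.1
      rw [hn, ← hf] at this
      exact lt_irrefl _ this
    have := tendsto_coshConv (b := b) hε hρ hne
    rw [hf] at this
    exact (tendsto_const_nhds.sub (tendsto_const_nhds.mul this)).inv₀
      (limitProfile_pos hb hk hpos ⟨hx'.1, hx'.2.le⟩).ne'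

theorem tendsto_kinkReg (hb : 0 ≤ b) (hk : 0 ≤ k) (hpos : 0 < 1 + k - k * Real.cosh b)
    (hε : Tendsto ε atTop (𝓝 0)) (hρ : ∀ n, IsPeriodicBump (ε n) (ρ n)) {l : ℝ}
    (hl : Tendsto (fun n => (l * kinkNorm b k (ρ n)) ^ 2) atTop (𝓝 ((1 + 2 * k) * b ^ 2)))
    {x : ℝ} (hx : ∀ n : ℤ, x ≠ n) :
    Tendsto (fun n => kinkReg b k l (ρ n) x) atTop (𝓝 (-2 * b ^ 2)) := by
  have hC := tendsto_coshConv (b := b) hε hρ hx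
  have hS := tendsto_sinhConv (b := b) hε hρ hx
  have hp := limitProfile_pos hb hk hpos (fract_mem_Icc x)
  have hCS := Real.cosh_sq (2 * b * (Int.fract x - 1 / 2))
  set C := Real.cosh (2 * b * (Int.fract x - 1 / 2))
  set S := Real.sinh (2 * b * (Int.fract x - 1 / 2))
  have hy : Tendsto (fun n => kinkProfile b k (ρ n) x) atTop (𝓝 (1 + k - k * C)) :=
    tendsto_const_nhds.sub (tendsto_const_nhds.mul hC)
  have h := (((((tendsto_const_nhds (x := 4 * k * b ^ 2)).mul hC).mul hy).add
    ((((tendsto_const_nhds (x := k * b)).mul hS).pow 2).const_mul 2)).sub (hl.const_mul 2)).div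
    (hy.pow 2) (pow_ne_zero 2 hp.ne')
  have e : (4 * k * b ^ 2 * C * (1 + k - k * C) + 2 * (k * b * S) ^ 2 - 2 * ((1 + 2 * k) * b ^ 2))
      / (1 + k - k * C) ^ 2 = -2 * b ^ 2 := by
    have hp' := hp.ne'
    rw [div_eq_iff (pow_ne_zero 2 hp')]
    linear_combination (-2 * b ^ 2 * k ^ 2) * hCS
  rw [e] at h
  exact h

/-- The singular term needs the profile on the support of ρ, near ℤ, where the pointwise limit is
not available. There the weight may concentrate at both ends of [0, 1], and the cosh kernel equals
cosh b at each. -/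
theorem eventually_coshConv_near (hε : Tendsto ε atTop (𝓝 0))
    (hρ : ∀ n, IsPeriodicBump (ε n) (ρ n)) {η : ℝ} (hη : 0 < η) :
    ∀ᶠ n in atTop, ∀ v : ℝ, (∃ m : ℤ, |v - m| < ε n) →
      |coshConv b (ρ n) v - Real.cosh b| ≤ η := by
  have hf : Continuous fun u : ℝ => Real.cosh (2 * b * (u - 1 / 2)) := by fun_prop
  have e0 : Real.cosh (2 * b * (0 - 1 / 2)) = Real.cosh b := by
    rw [← Real.cosh_neg]; congr 1; ring
  have e1 : Real.cosh (2 * b * (1 - 1 / 2)) = Real.cosh b := by congr 1; ring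
  obtain ⟨δ₀, hδ₀, h0⟩ := Metric.continuousAt_iff.1 (hf.continuousAt (x := 0)) η hη
  obtain ⟨δ₁, hδ₁, h1⟩ := Metric.continuousAt_iff.1 (hf.continuousAt (x := 1)) η hη
  simp only [Real.dist_eq, e0, e1] at h0 h1
  have hm : 0 < min (min δ₀ δ₁) 1 / 2 := by positivity
  filter_upwards [hε.eventually_lt_const hm] with n hn v ⟨m, hvm⟩
  have hn1 : 2 * ε n < δ₀ := by
    have := (min_le_left (min δ₀ δ₁) 1).trans (min_le_left _ _); linarith
  have hn2 : 2 * ε n < δ₁ := by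
    have := (min_le_left (min δ₀ δ₁) 1).trans (min_le_right _ _); linarith
  have hn3 : 2 * ε n < 1 := by
    have := min_le_right (min δ₀ δ₁) 1; linarith
  refine abs_integral_mul_sub_le ((hρ n).continuous.comp (by fun_prop)) hf
    (fun u => (hρ n).nonneg _) ((hρ n).integral_reflect v) fun u hu hne => ?_
  obtain ⟨m', hm'⟩ := (hρ n).support _ hne
  rw [abs_lt] at hvm hm'
  have k1 : |u - ((m - m' : ℤ) : ℝ)| < 2 * ε n := by
    push_cast
    rw [abs_lt]
    constructor <;> linarith [hvm.1, hvm.2, hm'.1, hm'.2]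
  set j : ℤ := m - m'
  have k2 := abs_lt.1 k1
  have a1 : (j : ℝ) < 2 := by linarith [hu.1, hu.2]
  have a2 : (-1 : ℝ) < j := by linarith [hu.1, hu.2]
  have a1' : j < 2 := by exact_mod_cast a1
  have a2' : -1 < j := by exact_mod_cast a2
  obtain hj | hj : j = 0 ∨ j = 1 := by omega
  · rw [hj] at k1
    push_cast at k1
    exact (h0 (k1.trans hn1)).le
  · rw [hj] at k1
    push_cast at k1
    exact (h1 (k1.trans hn2)).le

/-- Quantitative injectivity modulo ℤ. Keeping t away from 0 and 1 prevents a second point of [0, 1]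
from mapping near Φ t modulo ℤ. -/
theorem IsDiffLift.exists_near_of_near_int {Φ : ℝ → ℝ} {j : ℕ} (hΦ : IsDiffLift j Φ) {t δ : ℝ}
    (ht : t ∈ Set.Ioo (0 : ℝ) 1) (hδ : 0 < δ) :
    ∃ r > 0, ∀ τ ∈ Set.Icc (0 : ℝ) 1, (∃ m : ℤ, |Φ τ - Φ t - m| < r) → |τ - t| < δ := by
  have hm := hΦ.strictMono
  have h01 := hΦ.map_add_one 0
  rw [zero_add] at h01
  let d := min δ (min t (1 - t))
  have hd : 0 < d := lt_min hδ (lt_min ht.1 (by linarith [ht.2]))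
  have hd1 : d ≤ δ := min_le_left _ _
  have hd2 : d ≤ t := (min_le_right _ _).trans (min_le_left _ _)
  have hd3 : d ≤ 1 - t := (min_le_right _ _).trans (min_le_right _ _)
  have hA : Φ (t - d) < Φ t := hm (by linarith)
  have hB : Φ t < Φ (t + d) := hm (by linarith)
  have hA0 : Φ 0 ≤ Φ (t - d) := hm.monotone (by linarith)
  have hB1 : Φ (t + d) ≤ Φ 1 := hm.monotone (by linarith)
  refine ⟨min (Φ t - Φ (t - d)) (Φ (t + d) - Φ t), lt_min (by linarith) (by linarith), ?_⟩
  rintro τ hτ ⟨m, hr⟩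
  rw [lt_min_iff, abs_lt, abs_lt] at hr
  by_contra hcon
  rw [not_lt, le_abs] at hcon
  rcases hcon with h | h
  · have h1 : Φ (t + d) ≤ Φ τ := hm.monotone (by linarith)
    have h2 : Φ τ ≤ Φ 1 := hm.monotone hτ.2
    have a1 : (0 : ℝ) < m := by linarith [hr.1.1, hr.1.2, hr.2.1, hr.2.2]
    have a2 : (m : ℝ) < 1 := by linarith [hr.1.1, hr.1.2, hr.2.1, hr.2.2]
    have a1' : 0 < m := by exact_mod_cast a1
    have a2' : m < 1 := by exact_mod_cast a2
    omega
  · have h1 : Φ τ ≤ Φ (t - d) := hm.monotone (by linarith)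
    have h2 : Φ 0 ≤ Φ τ := hm.monotone hτ.1
    have a1 : (-1 : ℝ) < m := by linarith [hr.1.1, hr.1.2, hr.2.1, hr.2.2]
    have a2 : (m : ℝ) < 0 := by linarith [hr.1.1, hr.1.2, hr.2.1, hr.2.2]
    have a1' : -1 < m := by exact_mod_cast a1
    have a2' : m < 0 := by exact_mod_cast a2
    omega

/-- One factor Φ' makes ρ(Φ τ - Φ t) a probability density concentrating at t; the other factor Φ',
divided by the profile, is what is evaluated there. -/
theorem tendsto_integral_bump_div_kinkProfile (hb : 0 ≤ b) (hk : 0 ≤ k)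
    (hpos : 0 < 1 + k - k * Real.cosh b)
    (hε : Tendsto ε atTop (𝓝 0)) (hρ : ∀ n, IsPeriodicBump (ε n) (ρ n)) {Φ : ℝ → ℝ}
    (hΦ : IsDiffLift 1 Φ) {t : ℝ} (ht : t ∈ Set.Ioo (0 : ℝ) 1) :
    Tendsto (fun n => ∫ τ in (0 : ℝ)..1,
      ρ n (Φ τ - Φ t) / kinkProfile b k (ρ n) (Φ τ - Φ t) * deriv Φ τ ^ 2) atTop
      (𝓝 (deriv Φ t / (1 + k - k * Real.cosh b))) := by
  have hΦc := hΦ.contDiff.continuous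
  have hΦd := hΦ.continuous_deriv le_rfl
  rw [Metric.tendsto_atTop']
  intro η hη
  have hdiv : ContinuousAt (fun p : ℝ × ℝ => p.1 / (1 + k - k * p.2)) (deriv Φ t, Real.cosh b) :=
    ContinuousAt.div (by fun_prop) (by fun_prop) hpos.ne'
  obtain ⟨δ, hδ, hdδ⟩ := Metric.continuousAt_iff.1 hdiv (η / 2) (half_pos hη)
  obtain ⟨δ', hδ', hΦδ⟩ := Metric.continuousAt_iff.1 (hΦd.continuousAt (x := t)) δ hδ
  obtain ⟨r, hr, hnear⟩ := hΦ.exists_near_of_near_int ht hδ'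
  obtain ⟨N, hN⟩ := eventually_atTop.1 ((hε.eventually_lt_const hr).and
    (eventually_coshConv_near (b := b) hε hρ (half_pos hδ)))
  refine ⟨N, fun n hn => ?_⟩
  obtain ⟨hn1, hn2⟩ := hN n hn.le
  have hyc : Continuous (kinkProfile b k (ρ n)) := (contDiff_kinkProfile (hρ n)).continuous
  have hy := fun x => (kinkProfile_pos hb hk hpos (hρ n) x).ne'
  have hρc := (hρ n).continuous
  have e : (∫ τ in (0 : ℝ)..1,
      ρ n (Φ τ - Φ t) / kinkProfile b k (ρ n) (Φ τ - Φ t) * deriv Φ τ ^ 2)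
      = ∫ τ in (0 : ℝ)..1, (deriv Φ τ / kinkProfile b k (ρ n) (Φ τ - Φ t))
        * (ρ n (Φ τ - Φ t) * deriv Φ τ) :=
    intervalIntegral.integral_congr fun τ _ => by ring
  rw [Real.dist_eq, e]
  refine lt_of_le_of_lt (abs_integral_mul_sub_le (by fun_prop)
    (Continuous.div hΦd (by fun_prop) fun _ => hy _)
    (fun u => mul_nonneg ((hρ n).nonneg _) (hΦ.deriv_pos u).le)
    ((hρ n).integral_comp_mul_deriv hΦ (Φ t)) fun τ hτ hne => ?_) (half_lt_self hη)
  obtain ⟨m, hm⟩ := (hρ n).support _ (left_ne_zero_of_mul hne)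
  have h1 := hnear τ hτ ⟨m, hm.trans hn1⟩
  have h2 := hn2 _ ⟨m, hm⟩
  have h3 := hΦδ (x := τ) h1
  have := hdδ (x := (deriv Φ τ, coshConv b (ρ n) (Φ τ - Φ t))) (by
    rw [Prod.dist_eq, max_lt_iff]
    exact ⟨h3, by rw [Real.dist_eq]; linarith⟩)
  exact this.le

theorem tendsto_integral_potential (hb : 0 ≤ b) (hk : 0 ≤ k)
    (hpos : 0 < 1 + k - k * Real.cosh b)
    (hε : Tendsto ε atTop (𝓝 0)) (hρ : ∀ n, IsPeriodicBump (ε n) (ρ n)) {l : ℝ}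
    (hl : Tendsto (fun n => (l * kinkNorm b k (ρ n)) ^ 2) atTop (𝓝 ((1 + 2 * k) * b ^ 2)))
    {Φ : ℝ → ℝ} (hΦ : IsDiffLift 1 Φ) {t : ℝ} (ht : t ∈ Set.Ioo (0 : ℝ) 1) :
    Tendsto (fun n => ∫ τ in (0 : ℝ)..1,
      (kinkReg b k l (ρ n) (Φ τ - Φ t) - 4 * k * b * Real.sinh b
        * (ρ n (Φ τ - Φ t) / kinkProfile b k (ρ n) (Φ τ - Φ t))) * deriv Φ τ ^ 2) atTop
      (𝓝 (-2 * b ^ 2 * (∫ τ in (0 : ℝ)..1, deriv Φ τ ^ 2)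
        - 4 * k * b * Real.sinh b * (deriv Φ t / (1 + k - k * Real.cosh b)))) := by
  have hΦc := hΦ.contDiff.continuous
  have hΦd := hΦ.continuous_deriv le_rfl
  have hrc := fun n => continuous_kinkReg hb hk hpos (hρ n) l
  have hyc : ∀ n, Continuous fun τ => ρ n (Φ τ - Φ t) / kinkProfile b k (ρ n) (Φ τ - Φ t) :=
    fun n => ((hρ n).continuous.comp (by fun_prop)).div
      ((contDiff_kinkProfile (hρ n)).continuous.comp (by fun_prop))
      fun x => (kinkProfile_pos hb hk hpos (hρ n) _).ne'
  have h2 := (tendsto_integral_bump_div_kinkProfile hb hk hpos hε hρ hΦ ht).const_mul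
    (4 * k * b * Real.sinh b)
  have h1 : Tendsto (fun n => ∫ τ in (0 : ℝ)..1,
      kinkReg b k l (ρ n) (Φ τ - Φ t) * deriv Φ τ ^ 2) atTop
      (𝓝 (∫ τ in (0 : ℝ)..1, -2 * b ^ 2 * deriv Φ τ ^ 2)) := by
    refine intervalIntegral.tendsto_integral_filter_of_dominated_convergence
      (fun τ => (4 * k * b ^ 2 * Real.cosh b + 2 * (k * b) ^ 2 * Real.cosh b ^ 2
      + 2 * l ^ 2) / (1 + k - k * Real.cosh b) ^ 2 * deriv Φ τ ^ 2)
      (Eventually.of_forall fun n => Continuous.aestronglyMeasurable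
        (((hrc n).comp (by fun_prop)).mul (by fun_prop)))
      (Eventually.of_forall fun n => Eventually.of_forall fun τ _ => ?_)
      (Continuous.intervalIntegrable (by fun_prop) _ _) ?_
    · rw [norm_mul, Real.norm_eq_abs, Real.norm_of_nonneg (sq_nonneg _)]
      exact mul_le_mul_of_nonneg_right (abs_kinkReg_le hb hk hpos (hρ n) l _) (sq_nonneg _)
    -- For τ ≠ t the difference Φ τ - Φ t is not an integer, so the regular part converges there.
    · have a1 : ∀ᵐ x : ℝ, x ≠ t := by simp [ae_iff, measure_singleton]
      filter_upwards [a1] with τ hτ1 hτ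
      rw [Set.uIoc_of_le zero_le_one] at hτ
      refine Tendsto.mul_const _ (tendsto_kinkReg hb hk hpos hε hρ hl fun m hm => hτ1 ?_)
      by_contra hcon
      obtain ⟨r, hr, hnear⟩ := hΦ.exists_near_of_near_int ht (abs_pos.2 (sub_ne_zero.2 hcon))
      exact lt_irrefl _ (hnear τ ⟨hτ.1.le, hτ.2⟩ ⟨m, by rw [hm, sub_self, abs_zero]; exact hr⟩)
  rw [intervalIntegral.integral_const_mul] at h1
  refine (h1.sub h2).congr fun n => ?_
  rw [← intervalIntegral.integral_const_mul, ← intervalIntegral.integral_sub]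
  · refine intervalIntegral.integral_congr fun τ _ => ?_
    ring
  · exact (((hrc n).comp (by fun_prop)).mul (by fun_prop) : Continuous fun τ =>
      kinkReg b k l (ρ n) (Φ τ - Φ t) * deriv Φ τ ^ 2).intervalIntegrable _ _
  · exact (continuous_const.mul ((hyc n).mul (hΦd.pow 2))).intervalIntegrable _ _

end KinkLimit

/-! ### Hyperbolic parametrization -/

/-- The strength of the kink that turns the parameter `b` into `l`. -/
noncomputable def kinkParam (b l : ℝ) : ℝ :=
  ((Real.sinh (l / 2) * Real.cosh (b / 2) / (Real.cosh (l / 2) * Real.sinh (b / 2))) ^ 2 - 1) / 2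

section Param

variable {b l : ℝ}

theorem kinkParam_eq (hb : 0 < b) : kinkParam b l
    = (Real.sinh (l / 2) ^ 2 - Real.sinh (b / 2) ^ 2)
      / (2 * Real.cosh (l / 2) ^ 2 * Real.sinh (b / 2) ^ 2) := by
  have h1 := (Real.sinh_pos_iff.2 (half_pos hb)).ne'
  have h2 := (Real.cosh_pos (l / 2)).ne'
  rw [kinkParam]
  field_simp
  rw [Real.cosh_sq, Real.cosh_sq]
  ring

theorem kinkParam_nonneg (hb : 0 < b) (hbl : b < l) : 0 ≤ kinkParam b l := by
  rw [kinkParam_eq hb]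
  have h1 := Real.sinh_pos_iff.2 (half_pos hb)
  have h2 : Real.sinh (b / 2) < Real.sinh (l / 2) := Real.sinh_lt_sinh.2 (by linarith)
  have : 0 ≤ Real.sinh (l / 2) ^ 2 - Real.sinh (b / 2) ^ 2 := by nlinarith
  positivity

theorem cosh_eq_half (b : ℝ) : Real.cosh b = 1 + 2 * Real.sinh (b / 2) ^ 2 := by
  have := Real.cosh_two_mul (b / 2)
  rw [mul_div_cancel₀ b two_ne_zero, Real.cosh_sq] at this
  linarith

theorem sinh_eq_half (b : ℝ) : Real.sinh b = 2 * Real.sinh (b / 2) * Real.cosh (b / 2) := by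
  have := Real.sinh_two_mul (b / 2)
  rwa [mul_div_cancel₀ b two_ne_zero] at this

/-- This is the smallest value of the limiting profile, attained at the kink; its positivity keeps
all the smoothed profiles positive. -/
theorem kinkParam_min (hb : 0 < b) :
    1 + kinkParam b l - kinkParam b l * Real.cosh b
      = Real.cosh (b / 2) ^ 2 / Real.cosh (l / 2) ^ 2 := by
  have h1 := (Real.sinh_pos_iff.2 (half_pos hb)).ne'
  have h2 := (Real.cosh_pos (l / 2)).ne'
  rw [kinkParam_eq hb, cosh_eq_half b]
  field_simp
  rw [Real.cosh_sq, Real.cosh_sq]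
  ring

theorem kinkParam_min_pos (hb : 0 < b) :
    0 < 1 + kinkParam b l - kinkParam b l * Real.cosh b := by
  rw [kinkParam_min hb]
  have := Real.cosh_pos (b / 2)
  have := Real.cosh_pos (l / 2)
  positivity

/-- The weight of the limiting Dirac mass. That it is affine in cosh l later makes it a usable
Laplace variable. -/
theorem kinkParam_jump (hb : 0 < b) :
    4 * kinkParam b l * b * Real.sinh b / (1 + kinkParam b l - kinkParam b l * Real.cosh b)
      = 4 * b * (Real.cosh l - Real.cosh b) / Real.sinh b := by
  have h1 := (Real.sinh_pos_iff.2 (half_pos hb)).ne'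
  have h2 := (Real.cosh_pos (l / 2)).ne'
  have h3 := (Real.cosh_pos (b / 2)).ne'
  rw [kinkParam_min hb, kinkParam_eq hb, cosh_eq_half b, cosh_eq_half l, sinh_eq_half b]
  field_simp
  ring

/-- With z = b(u - 1/2) and 1 + 2k = c², the profile is cosh² z - c² sinh² z. It splits into two
linear factors in cosh z and sinh z, and the logarithm of their quotient is a primitive up to the
factor 2bc. -/
theorem integral_inv_limitProfile (hb : 0 < b) (hbl : b < l) :
    ∫ u in (0 : ℝ)..1,
      (1 + kinkParam b l - kinkParam b l * Real.cosh (2 * b * (u - 1 / 2)))⁻¹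
      = l / (b * (Real.sinh (l / 2) * Real.cosh (b / 2)
        / (Real.cosh (l / 2) * Real.sinh (b / 2)))) := by
  have hk := kinkParam_nonneg hb hbl
  have hpos := kinkParam_min_pos (l := l) hb
  have s1 := Real.sinh_pos_iff.2 (half_pos hb)
  have s2 := Real.sinh_pos_iff.2 (half_pos (hb.trans hbl))
  have c1 := Real.cosh_pos (b / 2)
  have c2 := Real.cosh_pos (l / 2)
  set c := Real.sinh (l / 2) * Real.cosh (b / 2) / (Real.cosh (l / 2) * Real.sinh (b / 2)) with hc
  have hcpos : 0 < c := by positivity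
  have hkc : kinkParam b l = (c ^ 2 - 1) / 2 := rfl
  clear_value c
  have hy : ∀ u : ℝ, 1 + kinkParam b l - kinkParam b l * Real.cosh (2 * b * (u - 1 / 2))
      = (Real.cosh (b * (u - 1 / 2)) + c * Real.sinh (b * (u - 1 / 2)))
        * (Real.cosh (b * (u - 1 / 2)) - c * Real.sinh (b * (u - 1 / 2))) := fun u => by
    rw [hkc, mul_assoc 2 b, Real.cosh_two_mul, Real.cosh_sq]
    linear_combination -Real.cosh_sq (b * (u - 1 / 2))
  have hfac : ∀ u ∈ Set.Icc (0 : ℝ) 1,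
      0 < Real.cosh (b * (u - 1 / 2)) + c * Real.sinh (b * (u - 1 / 2)) ∧
      0 < Real.cosh (b * (u - 1 / 2)) - c * Real.sinh (b * (u - 1 / 2)) := fun u hu => by
    have h1 := limitProfile_pos hb.le hk hpos hu
    rw [hy, mul_pos_iff] at h1
    -- The factors cannot both be negative, since their sum is 2 cosh.
    rcases h1 with h1 | h1
    · exact h1
    · have := Real.cosh_pos (b * (u - 1 / 2))
      linarith [h1.1, h1.2]
  have hder : ∀ u ∈ Set.uIcc (0 : ℝ) 1, HasDerivAt (fun u =>
      (Real.log (Real.cosh (b * (u - 1 / 2)) + c * Real.sinh (b * (u - 1 / 2)))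
        - Real.log (Real.cosh (b * (u - 1 / 2)) - c * Real.sinh (b * (u - 1 / 2)))) / (2 * b * c))
      (1 + kinkParam b l - kinkParam b l * Real.cosh (2 * b * (u - 1 / 2)))⁻¹ u := by
    intro u hu
    rw [Set.uIcc_of_le zero_le_one] at hu
    obtain ⟨p1, p2⟩ := hfac u hu
    have hz : HasDerivAt (fun u : ℝ => b * (u - 1 / 2)) b u := by
      exact (((hasDerivAt_id' u).sub_const (1 / 2)).const_mul b).congr_deriv (mul_one b)
    have h1 := (hz.cosh.add (hz.sinh.const_mul c)).log p1.ne'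
    have h2 := (hz.cosh.sub (hz.sinh.const_mul c)).log p2.ne'
    refine ((h1.sub h2).div_const (2 * b * c)).congr_deriv ?_
    rw [hy]
    simp only [Pi.add_apply, Pi.sub_apply]
    have p1' := p1.ne'
    have p2' := p2.ne'
    have hcs := Real.cosh_sq (b * (u - 1 / 2))
    generalize Real.cosh (b * (u - 1 / 2)) = C at *
    generalize Real.sinh (b * (u - 1 / 2)) = S at *
    rw [div_sub_div _ _ p1' p2', div_div, inv_eq_one_div,
      div_eq_div_iff (by positivity) (by positivity)]
    linear_combination 2 * b * c * (C + c * S) * (C - c * S) * hcs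
  have hcont : ContinuousOn (fun u : ℝ =>
      (1 + kinkParam b l - kinkParam b l * Real.cosh (2 * b * (u - 1 / 2)))⁻¹)
      (Set.uIcc 0 1) := by
    refine ContinuousOn.inv₀ (by fun_prop) fun u hu => ?_
    rw [Set.uIcc_of_le zero_le_one] at hu
    exact (limitProfile_pos hb.le hk hpos hu).ne'
  rw [intervalIntegral.integral_eq_sub_of_hasDerivAt hder hcont.intervalIntegrable]
  have z1 : b * (1 - 1 / 2) = b / 2 := by ring
  have z0 : b * (0 - 1 / 2) = -(b / 2) := by ring
  -- The choice c = tanh(l/2)/tanh(b/2) makes the endpoint values of the factors proportional to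
  -- exp(±l/2), so the logarithms yield l.
  have q1 : Real.cosh (b / 2) + c * Real.sinh (b / 2)
      = Real.cosh (b / 2) / Real.cosh (l / 2) * Real.exp (l / 2) := by
    rw [← Real.cosh_add_sinh, hc]
    field_simp
  have q2 : Real.cosh (b / 2) - c * Real.sinh (b / 2)
      = Real.cosh (b / 2) / Real.cosh (l / 2) * Real.exp (-(l / 2)) := by
    rw [← Real.cosh_sub_sinh, hc]
    field_simp
  have hr : Real.cosh (b / 2) / Real.cosh (l / 2) ≠ 0 := by positivity
  rw [z1, z0, Real.cosh_neg, Real.sinh_neg, mul_neg, ← sub_eq_add_neg, sub_neg_eq_add, q1, q2,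
    Real.log_mul hr (Real.exp_ne_zero _), Real.log_mul hr (Real.exp_ne_zero _), Real.log_exp,
    Real.log_exp]
  field_simp
  ring

end Param

/-- Potentials of `C³` diffeomorphisms that concentrate to a Dirac mass at `0`. -/
theorem exists_potentials {b l : ℝ} (hb : 0 < b) (hbl : b < l) :
    ∃ Ψ : ℕ → ℝ → ℝ, (∀ n, IsDiffLift 3 (Ψ n)) ∧
      (∀ δ > 0, ∀ᶠ n in atTop, ∀ x,
        schwarzian (Ψ n) x + 2 * (-l ^ 2) * deriv (Ψ n) x ^ 2 ≤ -2 * b ^ 2 + δ) ∧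
      ∀ Φ, IsDiffLift 1 Φ → ∀ t ∈ Set.Ioo (0 : ℝ) 1, Tendsto (fun n => ∫ τ in (0 : ℝ)..1,
        (schwarzian (Ψ n) (Φ τ - Φ t) + 2 * (-l ^ 2) * deriv (Ψ n) (Φ τ - Φ t) ^ 2)
          * deriv Φ τ ^ 2) atTop
        (𝓝 (-2 * b ^ 2 * (∫ τ in (0 : ℝ)..1, deriv Φ τ ^ 2)
          - 4 * b * (Real.cosh l - Real.cosh b) / Real.sinh b * deriv Φ t)) := by
  have hε0 : ∀ n : ℕ, (0 : ℝ) < 1 / ((n : ℝ) + 1) := fun n => Nat.one_div_pos_of_nat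
  choose ρ hρ using fun n => exists_isPeriodicBump (hε0 n)
  have hε : Tendsto (fun n : ℕ => 1 / ((n : ℝ) + 1)) atTop (𝓝 0) :=
    tendsto_one_div_add_atTop_nhds_zero_nat
  have hk := kinkParam_nonneg hb hbl
  have hpos := kinkParam_min_pos (l := l) hb
  have s1 := Real.sinh_pos_iff.2 (half_pos hb)
  have s2 := Real.sinh_pos_iff.2 (half_pos (hb.trans hbl))
  have c1 := Real.cosh_pos (b / 2)
  have c2 := Real.cosh_pos (l / 2)
  have hl0 := hb.trans hbl
  have hI := integral_inv_limitProfile hb hbl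
  -- The limiting normalization is bc/l with c² = 1 + 2k: exactly the condition that flattens the
  -- regular part to -2b².
  have hl : Tendsto (fun n => (l * kinkNorm b (kinkParam b l) (ρ n)) ^ 2) atTop
      (𝓝 ((1 + 2 * kinkParam b l) * b ^ 2)) := by
    have := tendsto_kinkNorm hb.le hk hpos hε hρ (by rw [hI]; positivity)
    rw [hI] at this
    convert (this.const_mul l).pow 2 using 2
    rw [kinkParam]
    field_simp
    ring
  have hpot := fun n => potential_kinkLift hb.le hk hpos (hρ n) l
  refine ⟨fun n => kinkLift b (kinkParam b l) (ρ n),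
    fun n => isDiffLift_kinkLift hb.le hk hpos (hρ n), fun δ hδ => ?_, fun Φ hΦ t ht => ?_⟩
  · have h1 : Tendsto (fun n => 2 * |(1 + 2 * kinkParam b l) * b ^ 2
        - (l * kinkNorm b (kinkParam b l) (ρ n)) ^ 2|
        / (1 + kinkParam b l - kinkParam b l * Real.cosh b) ^ 2) atTop (𝓝 0) := by
      have := (((tendsto_const_nhds (x := (1 + 2 * kinkParam b l) * b ^ 2)).sub hl).abs.const_mul
        2).div_const ((1 + kinkParam b l - kinkParam b l * Real.cosh b) ^ 2)
      simpa using this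
    filter_upwards [h1.eventually_lt_const hδ] with n hn x
    rw [hpot n x]
    have h2 := kinkReg_le hb.le hk hpos (hρ n) l x
    have h3 : 0 ≤ 4 * kinkParam b l * b * Real.sinh b
        * (ρ n x / kinkProfile b (kinkParam b l) (ρ n) x) := by
      have := (hρ n).nonneg x
      have := kinkProfile_pos hb.le hk hpos (hρ n) x
      have := Real.sinh_pos_iff.2 hb
      positivity
    linarith
  · have h1 := tendsto_integral_potential hb.le hk hpos hε hρ hl hΦ ht
    simp only [hpot]
    rw [← mul_div_assoc, mul_div_right_comm, kinkParam_jump hb] at h1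
    exact h1

/-! ### Averaging over the position of the kink -/

section Averaging

open CircleDiff

/-- The average over `θ` of the exponential of the potential `W (φ - θ)`. -/
noncomputable def averagedWeight (v : ℝ) (W : UnitAddCircle → ℝ) (φ : CircleDiff 1) : ℝ :=
  ∫ θ : UnitAddCircle,
    Real.exp (1 / v * ∫ τ : UnitAddCircle, W (φ.toFun τ - θ) * φ.deriv τ ^ 2)

section Averaged

variable {v : ℝ} {W : UnitAddCircle → ℝ}

theorem continuous_shifted_weight (v : ℝ) (hW : Continuous W) :
    Continuous fun p : UnitAddCircle × CircleDiff 1 =>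
      Real.exp (1 / v * ∫ τ : UnitAddCircle, W (p.2.toFun τ - p.1) * p.2.deriv τ ^ 2) :=
  Real.continuous_exp.comp (continuous_const.mul (continuous_integral_comp_mul_deriv_sq
    (W := fun θ x => W (x - θ)) (hW.comp (continuous_snd.sub continuous_fst))))

theorem continuous_lifted_weight (v : ℝ) (hW : Continuous W) (φ : CircleDiff 1) :
    Continuous fun t : ℝ => Real.exp (1 / v * ∫ τ in (0 : ℝ)..1,
      W ((φ.lift τ - φ.lift t : ℝ) : UnitAddCircle) * deriv φ.lift τ ^ 2) := by
  have := (continuous_shifted_weight v hW).comp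
    (((AddCircle.continuous_mk' 1).comp φ.isDiffLift_lift.contDiff.continuous).prodMk
      (continuous_const (y := φ)))
  convert this using 1
  funext t
  simp only [Function.comp_apply]
  rw [← UnitAddCircle.intervalIntegral_preimage 0, zero_add]
  simp only [coe_lift φ, AddCircle.coe_sub, deriv_coe_lift]
  rfl

theorem continuous_averagedWeight (v : ℝ) (hW : Continuous W) :
    Continuous (averagedWeight v W) :=
  continuous_integral_unitAddCircle (f := fun (φ : CircleDiff 1) θ =>
    Real.exp (1 / v * ∫ τ : UnitAddCircle, W (φ.toFun τ - θ) * φ.deriv τ ^ 2))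
    ((continuous_shifted_weight v hW).comp continuous_swap)

theorem CircleDiff.integral_comp_toFun_mul_deriv {f : UnitAddCircle → ℝ} (hf : Continuous f)
    (φ : CircleDiff 1) :
    ∫ θ, f θ = ∫ t in (0 : ℝ)..1, f (φ.lift t : ℝ) * _root_.deriv φ.lift t := by
  have hΦ := φ.isDiffLift_lift
  have h1 := intervalIntegral.integral_comp_mul_deriv (a := 0) (b := 1) (f := φ.lift)
    (f' := _root_.deriv φ.lift) (g := fun x : ℝ => f x) (fun x _ => hΦ.hasDerivAt le_rfl x)
    (hΦ.continuous_deriv le_rfl).continuousOn (hf.comp (AddCircle.continuous_mk' 1))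
  have h2 := hΦ.map_add_one 0
  rw [zero_add] at h2
  rw [h2, UnitAddCircle.intervalIntegral_preimage] at h1
  exact h1.symm

/-- The substitution θ = φ(t) places the kink at a point of the image curve; its Jacobian is the
outer factor φ'(t). -/
theorem averagedWeight_eq (hW : Continuous W) (φ : CircleDiff 1) :
    averagedWeight v W φ = ∫ t in (0 : ℝ)..1,
      Real.exp (1 / v * ∫ τ in (0 : ℝ)..1,
        W ((φ.lift τ - φ.lift t : ℝ) : UnitAddCircle) * deriv φ.lift τ ^ 2) * deriv φ.lift t := by
  rw [averagedWeight, φ.integral_comp_toFun_mul_deriv (f := fun θ =>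
    Real.exp (1 / v * ∫ τ : UnitAddCircle, W (φ.toFun τ - θ) * φ.deriv τ ^ 2))
    ((continuous_shifted_weight v hW).comp (continuous_id.prodMk continuous_const))]
  refine intervalIntegral.integral_congr fun t _ => ?_
  rw [← UnitAddCircle.intervalIntegral_preimage 0, zero_add]
  simp only [coe_lift φ, AddCircle.coe_sub, deriv_coe_lift]

theorem CircleDiff.energy_eq (φ : CircleDiff 1) :
    φ.energy = ∫ τ in (0 : ℝ)..1, _root_.deriv φ.lift τ ^ 2 := by
  rw [energy, ← UnitAddCircle.intervalIntegral_preimage 0, zero_add]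
  rfl

/-- The circle has mass one, so a quantity independent of θ equals its average, and Tonelli moves
the average inside. -/
theorem lintegral_averagedWeight {ν : Measure (CircleDiff 1)} [SFinite ν] (hW : Continuous W)
    {z : ℝ≥0∞} (h : ∀ θ : UnitAddCircle, z = ∫⁻ φ, ENNReal.ofReal (Real.exp (1 / v *
      ∫ τ : UnitAddCircle, W (φ.toFun τ - θ) * φ.deriv τ ^ 2)) ∂ν) :
    z = ∫⁻ φ, ENNReal.ofReal (averagedWeight v W φ) ∂ν := by
  have hc := continuous_shifted_weight v hW
  calc z = ∫⁻ _ : UnitAddCircle, z := by simp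
    _ = ∫⁻ θ : UnitAddCircle, ∫⁻ φ, ENNReal.ofReal (Real.exp (1 / v *
      ∫ τ : UnitAddCircle, W (φ.toFun τ - θ) * φ.deriv τ ^ 2)) ∂ν := lintegral_congr h
    _ = ∫⁻ φ, (∫⁻ θ : UnitAddCircle, ENNReal.ofReal (Real.exp (1 / v *
      ∫ τ : UnitAddCircle, W (φ.toFun τ - θ) * φ.deriv τ ^ 2))) ∂ν :=
        lintegral_lintegral_swap hc.measurable.ennreal_ofReal.aemeasurable
    _ = _ := by
        refine lintegral_congr fun φ => ?_
        rw [averagedWeight, ofReal_integral_eq_lintegral_ofReal]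
        · exact (hc.comp (continuous_id.prodMk continuous_const)).integrable_of_hasCompactSupport
            (HasCompactSupport.of_compactSpace _)
        · exact Eventually.of_forall fun _ => (Real.exp_pos _).le

end Averaged

/-! ### Total masses at negative parameters as Laplace transforms. -/

section Family

variable {σsq : ℝ} {μ : ℝ → Measure (CircleDiff 1)}

/-- Regularity supplies a finite member of the family, and `μ 0` has a density with respect to it.
This licenses every use of Tonelli. -/
theorem IsRegularOrbitalFamily.sFinite (hμ : IsRegularOrbitalFamily σsq μ) : SFinite (μ 0) := by
  obtain ⟨a₀, hr, h⟩ := hμ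
  obtain ⟨c, hc⟩ := hr.regular
  have hm : ∀ c : ℝ, Measurable fun φ : CircleDiff 1 =>
      ENNReal.ofReal (Real.exp (c * φ.energy)) := fun c =>
    (Real.continuous_exp.comp (continuous_const.mul continuous_energy)).measurable.ennreal_ofReal
  have : IsFiniteMeasure (changeOfOrbit σsq a₀ c (μ a₀)) := ⟨hc⟩
  have e : μ 0 = (changeOfOrbit σsq a₀ c (μ a₀)).withDensity
      fun φ => ENNReal.ofReal (Real.exp (2 * (0 - c) / σsq * φ.energy)) := by
    rw [h 0, changeOfOrbit, changeOfOrbit, ← withDensity_mul _ (hm _) (hm _)]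
    congr 1
    funext φ
    rw [Pi.mul_apply, ← ENNReal.ofReal_mul (Real.exp_nonneg _), ← Real.exp_add]
    congr 2
    ring
  rw [e]
  infer_instance

theorem IsRegularOrbitalFamily.measure_univ_eq_averagedWeight
    (hμ : IsRegularOrbitalFamily σsq μ) (a : ℝ) {Ψ : ℝ → ℝ} (hΨ : IsDiffLift 3 Ψ) :
    ∃ W : UnitAddCircle → ℝ, Continuous W ∧
      (∀ x : ℝ, W x = schwarzian Ψ x + 2 * a * deriv Ψ x ^ 2) ∧
      μ a Set.univ = ∫⁻ φ, ENNReal.ofReal (averagedWeight σsq W φ) ∂μ 0 := by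
  have hW : ∀ x : ℝ, (ofLift Ψ hΨ).schwarzian x + 2 * a * (ofLift Ψ hΨ).deriv x ^ 2
      = schwarzian Ψ x + 2 * a * deriv Ψ x ^ 2 := fun x => by
    rw [deriv_coe hΨ (ofLift_coe _ hΨ), schwarzian_coe hΨ (ofLift_coe _ hΨ)]
  have hc : Continuous fun x => (ofLift Ψ hΨ).schwarzian x + 2 * a * (ofLift Ψ hΨ).deriv x ^ 2 :=
    (ofLift Ψ hΨ).continuous_schwarzian.add
      (continuous_const.mul ((ofLift Ψ hΨ).continuous_deriv_three.pow 2))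
  refine ⟨fun x => (ofLift Ψ hΨ).schwarzian x + 2 * a * (ofLift Ψ hΨ).deriv x ^ 2, hc, hW, ?_⟩
  have := hμ.sFinite
  refine lintegral_averagedWeight hc fun θ => ?_
  induction θ using QuotientAddGroup.induction_on with
  | H θ =>
    rw [hμ.measure_univ_eq_of_lift a hΨ θ]
    refine lintegral_congr fun φ => ?_
    rw [← UnitAddCircle.intervalIntegral_preimage 0, zero_add]
    congr 3
    refine intervalIntegral.integral_congr fun τ _ => ?_
    rw [coe_lift φ, deriv_coe_lift, ← hW, AddCircle.coe_sub]

/-- The total mass as a Laplace transform of the law of the derivative of `φ`. -/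
theorem IsRegularOrbitalFamily.measure_univ_neg_sq_eq (hσ : 0 < σsq)
    (hμ : IsRegularOrbitalFamily σsq μ) {b l δ : ℝ} (hb : 0 < b) (hbl : b < l) (hδ : 0 < δ)
    (hfin : μ (-b ^ 2 + δ) Set.univ < ∞) :
    μ (-l ^ 2) Set.univ = ∫⁻ φ, ENNReal.ofReal (∫ τ : UnitAddCircle,
      Real.exp (1 / σsq * (-2 * b ^ 2 * φ.energy
        - 4 * b * (Real.cosh l - Real.cosh b) / Real.sinh b * φ.deriv τ)) * φ.deriv τ) ∂μ 0 := by
  obtain ⟨Ψ, hΨ, hle, hlim⟩ := exists_potentials hb hbl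
  choose W hWc hW hZ using fun n => hμ.measure_univ_eq_averagedWeight (-l ^ 2) (hΨ n)
  have hbound : ∀ᶠ n in atTop, ∀ x : ℝ, W n x ≤ -2 * b ^ 2 + 2 * δ := by
    filter_upwards [hle (2 * δ) (by positivity)] with n hn x
    rw [hW]
    exact hn x
  -- the exponential in the average is bounded by that of the energy
  have hexp : ∀ᶠ n in atTop, ∀ (φ : CircleDiff 1) (t : ℝ),
      Real.exp (1 / σsq * ∫ τ in (0 : ℝ)..1,
        W n ((φ.lift τ - φ.lift t : ℝ) : UnitAddCircle) * deriv φ.lift τ ^ 2)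
      ≤ Real.exp (2 * (-b ^ 2 + δ) / σsq * φ.energy) := by
    filter_upwards [hbound] with n hn φ t
    have hΦ := φ.isDiffLift_lift
    have hΦc := hΦ.contDiff.continuous
    have hΦd := hΦ.continuous_deriv le_rfl
    have hWn : Continuous fun τ : ℝ => W n ((φ.lift τ - φ.lift t : ℝ) : UnitAddCircle) :=
      (hWc n).comp ((AddCircle.continuous_mk' 1).comp (by fun_prop))
    have h1 : (∫ τ in (0 : ℝ)..1,
        W n ((φ.lift τ - φ.lift t : ℝ) : UnitAddCircle) * deriv φ.lift τ ^ 2)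
        ≤ (-2 * b ^ 2 + 2 * δ) * φ.energy := by
      rw [φ.energy_eq, ← intervalIntegral.integral_const_mul]
      exact intervalIntegral.integral_mono_on zero_le_one
        (Continuous.intervalIntegrable (by fun_prop) _ _)
        (Continuous.intervalIntegrable (by fun_prop) _ _)
        fun τ _ => mul_le_mul_of_nonneg_right (hn _) (sq_nonneg _)
    refine Real.exp_le_exp.2 ((mul_le_mul_of_nonneg_left h1 (by positivity)).trans_eq ?_)
    ring
  have hconv : ∀ φ : CircleDiff 1, Tendsto (fun n => averagedWeight σsq (W n) φ) atTop
      (𝓝 (∫ τ : UnitAddCircle, Real.exp (1 / σsq * (-2 * b ^ 2 * φ.energy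
        - 4 * b * (Real.cosh l - Real.cosh b) / Real.sinh b * φ.deriv τ)) * φ.deriv τ)) := by
    intro φ
    have hΦ := φ.isDiffLift_lift
    have hΦc := hΦ.contDiff.continuous
    have hΦd := hΦ.continuous_deriv le_rfl
    rw [← UnitAddCircle.intervalIntegral_preimage 0, zero_add]
    simp only [fun n => averagedWeight_eq (v := σsq) (hWc n) φ]
    refine intervalIntegral.tendsto_integral_filter_of_dominated_convergence
      (fun t => Real.exp (2 * (-b ^ 2 + δ) / σsq * φ.energy) * deriv φ.lift t)
      (Eventually.of_forall fun n => Continuous.aestronglyMeasurable ?_) ?_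
      (Continuous.intervalIntegrable (by fun_prop) _ _) ?_
    · exact (continuous_lifted_weight σsq (hWc n) φ).mul hΦd
    · filter_upwards [hexp] with n hn
      refine Eventually.of_forall fun t _ => ?_
      rw [norm_mul, Real.norm_of_nonneg (Real.exp_nonneg _),
        Real.norm_of_nonneg (hΦ.deriv_pos t).le]
      exact mul_le_mul_of_nonneg_right (hn φ t) (hΦ.deriv_pos t).le
    · have a1 : ∀ᵐ x : ℝ, x ≠ 1 := by simp [ae_iff, measure_singleton]
      filter_upwards [a1] with t ht1 ht
      rw [Set.uIoc_of_le zero_le_one] at ht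
      have := hlim φ.lift hΦ t ⟨ht.1, lt_of_le_of_ne ht.2 ht1⟩
      simp only [← hW, ← φ.energy_eq] at this
      exact ((Real.continuous_exp.tendsto _).comp (this.const_mul (1 / σsq))).mul_const _
  have hdom : ∀ᶠ n in atTop, ∀ φ : CircleDiff 1, averagedWeight σsq (W n) φ
      ≤ Real.exp (2 * (-b ^ 2 + δ) / σsq * φ.energy) := by
    filter_upwards [hexp] with n hn φ
    have hΦ := φ.isDiffLift_lift
    have hΦd := hΦ.continuous_deriv le_rfl
    have h01 := hΦ.map_add_one 0
    rw [zero_add] at h01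
    have hone : ∫ t in (0 : ℝ)..1, deriv φ.lift t = 1 := by
      rw [intervalIntegral.integral_eq_sub_of_hasDerivAt (fun x _ => hΦ.hasDerivAt le_rfl x)
        (hΦd.intervalIntegrable _ _), h01]
      ring
    calc averagedWeight σsq (W n) φ
        ≤ ∫ t in (0 : ℝ)..1, Real.exp (2 * (-b ^ 2 + δ) / σsq * φ.energy) * deriv φ.lift t := by
          rw [averagedWeight_eq (hWc n)]
          refine intervalIntegral.integral_mono_on zero_le_one ?_
            (Continuous.intervalIntegrable (by fun_prop) _ _)
            fun t _ => mul_le_mul_of_nonneg_right (hn φ t) (hΦ.deriv_pos t).le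
          exact ((continuous_lifted_weight σsq (hWc n) φ).mul hΦd).intervalIntegrable _ _
      _ = _ := by rw [intervalIntegral.integral_const_mul, hone, mul_one]
  have key : Tendsto (fun n => ∫⁻ φ, ENNReal.ofReal (averagedWeight σsq (W n) φ) ∂μ 0) atTop
      (𝓝 (∫⁻ φ, ENNReal.ofReal (∫ τ : UnitAddCircle,
      Real.exp (1 / σsq * (-2 * b ^ 2 * φ.energy
        - 4 * b * (Real.cosh l - Real.cosh b) / Real.sinh b * φ.deriv τ)) * φ.deriv τ) ∂μ 0)) := by
    refine tendsto_lintegral_filter_of_dominated_convergence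
      (fun φ => ENNReal.ofReal (Real.exp (2 * (-b ^ 2 + δ) / σsq * φ.energy)))
      (Eventually.of_forall fun n =>
        (continuous_averagedWeight σsq (hWc n)).measurable.ennreal_ofReal) ?_ ?_
      (Eventually.of_forall fun φ => (ENNReal.continuous_ofReal.tendsto _).comp (hconv φ))
    · filter_upwards [hdom] with n hn
      exact Eventually.of_forall fun φ => ENNReal.ofReal_le_ofReal (hn φ)
    -- The dominating function integrates to the mass at -b² + δ; the margin δ absorbs the smoothing
    -- error in the potential.
    · rw [← hμ.measure_univ]
      exact hfin.ne
  refine tendsto_nhds_unique (tendsto_const_nhds.congr fun n => hZ n) key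

end Family

end Averaging

/-! ### The integral equation for the total mass -/

section IntegralEquation

open CircleDiff

theorem lintegral_mul_exp_neg_mul_Ioi {c : ℝ} (hc : 0 < c) :
    ∫⁻ s in Set.Ioi (0 : ℝ), ENNReal.ofReal (Real.exp (-(s * c)) * c) = 1 := by
  have h1 : IntegrableOn (fun s : ℝ => Real.exp (-c * s)) (Set.Ioi 0) :=
    exp_neg_integrableOn_Ioi 0 hc
  have h2 := integral_exp_mul_Ioi (a := -c) (by linarith) 0
  have e : ∀ s : ℝ, -(s * c) = -c * s := fun s => by ring
  simp only [e]
  rw [← ofReal_integral_eq_lintegral_ofReal (h1.mul_const c)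
    (Eventually.of_forall fun s => by positivity), integral_mul_const, h2]
  have := hc.ne'
  simp [this]

/-- As l runs over (b, ∞), the kink strength sweeps all positive Laplace variables exactly once. -/
theorem lintegral_Ioi_eq_lintegral_sinh {b K : ℝ} (hb : 0 < b) (hK : 0 < K) (g : ℝ → ℝ≥0∞) :
    ∫⁻ s in Set.Ioi (0 : ℝ), g s = ∫⁻ l in Set.Ioi b,
      ENNReal.ofReal (K * Real.sinh l) * g (K * (Real.cosh l - Real.cosh b)) := by
  have himg : (fun l => K * (Real.cosh l - Real.cosh b)) '' Set.Ioi b = Set.Ioi 0 := by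
    ext y
    constructor
    · rintro ⟨l, hl, rfl⟩
      have : Real.cosh b < Real.cosh l := by
        rw [Real.cosh_lt_cosh, abs_of_pos hb, abs_of_pos (hb.trans hl)]
        exact hl
      exact mul_pos hK (sub_pos.2 this)
    · intro hy
      have hy' : 0 < y / K := div_pos hy hK
      have h1 : 1 ≤ Real.cosh b + y / K := by linarith [Real.one_le_cosh b]
      refine ⟨Real.arcosh (Real.cosh b + y / K), ?_, ?_⟩
      · have h2 : Real.cosh b < Real.cosh (Real.arcosh (Real.cosh b + y / K)) := by
          rw [Real.cosh_arcosh h1]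
          linarith
        rw [Real.cosh_lt_cosh, abs_of_pos hb, abs_of_nonneg (Real.arcosh_nonneg h1)] at h2
        exact h2
      · beta_reduce
        rw [Real.cosh_arcosh h1]
        field_simp
        ring
  have hder : ∀ l ∈ Set.Ioi b, HasDerivWithinAt (fun l => K * (Real.cosh l - Real.cosh b))
      (K * Real.sinh l) (Set.Ioi b) l := fun l _ =>
    (((Real.hasDerivAt_cosh l).sub_const _).const_mul K).hasDerivWithinAt
  have hinj : Set.InjOn (fun l => K * (Real.cosh l - Real.cosh b)) (Set.Ioi b) := by
    intro x hx y hy hxy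
    have h1 : Real.cosh x = Real.cosh y := by
      have := mul_left_cancel₀ hK.ne' hxy
      linarith
    exact Real.cosh_injOn (Set.mem_Ici.2 (hb.trans hx).le) (Set.mem_Ici.2 (hb.trans hy).le) h1
  rw [← himg, lintegral_image_eq_lintegral_abs_deriv_mul measurableSet_Ioi hder hinj]
  refine setLIntegral_congr_fun measurableSet_Ioi fun l hl => ?_
  rw [abs_of_pos (mul_pos hK (Real.sinh_pos_iff.2 (hb.trans hl)))]

/-- Integrating the Laplace transform of the derivative gives back the total mass. -/
theorem lintegral_laplace_deriv {ν : Measure (CircleDiff 1)} [SFinite ν] (c : ℝ) :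
    ∫⁻ s in Set.Ioi (0 : ℝ), ∫⁻ φ, ENNReal.ofReal (∫ τ : UnitAddCircle,
      Real.exp (c * φ.energy - s * φ.deriv τ) * φ.deriv τ) ∂ν
      = ∫⁻ φ, ENNReal.ofReal (Real.exp (c * φ.energy)) ∂ν := by
  have hd : Continuous fun q : (ℝ × CircleDiff 1) × UnitAddCircle => q.1.2.deriv q.2 :=
    continuous_deriv_apply.comp ((continuous_snd.comp continuous_fst).prodMk continuous_snd)
  have he : Continuous fun q : (ℝ × CircleDiff 1) × UnitAddCircle => q.1.2.energy :=
    continuous_energy.comp (continuous_snd.comp continuous_fst)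
  have hF : Continuous fun q : (ℝ × CircleDiff 1) × UnitAddCircle =>
      Real.exp (c * q.1.2.energy - q.1.1 * q.1.2.deriv q.2) * q.1.2.deriv q.2 := by fun_prop
  have hI : Continuous fun p : ℝ × CircleDiff 1 => ∫ τ : UnitAddCircle,
      Real.exp (c * p.2.energy - p.1 * p.2.deriv τ) * p.2.deriv τ :=
    continuous_integral_unitAddCircle (f := fun (p : ℝ × CircleDiff 1) τ =>
      Real.exp (c * p.2.energy - p.1 * p.2.deriv τ) * p.2.deriv τ) hF
  rw [lintegral_lintegral_swap hI.measurable.ennreal_ofReal.aemeasurable]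
  refine lintegral_congr fun φ => ?_
  have hφ := φ.continuous_deriv
  have hG : Continuous fun q : ℝ × UnitAddCircle =>
      Real.exp (c * φ.energy - q.1 * φ.deriv q.2) * φ.deriv q.2 := by fun_prop
  calc ∫⁻ s in Set.Ioi (0 : ℝ), ENNReal.ofReal (∫ τ : UnitAddCircle,
        Real.exp (c * φ.energy - s * φ.deriv τ) * φ.deriv τ)
      = ∫⁻ s in Set.Ioi (0 : ℝ), ∫⁻ τ : UnitAddCircle, ENNReal.ofReal (
        Real.exp (c * φ.energy - s * φ.deriv τ) * φ.deriv τ) := by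
        refine lintegral_congr fun s => ?_
        rw [ofReal_integral_eq_lintegral_ofReal]
        · exact Continuous.integrable_of_hasCompactSupport (by fun_prop)
            (HasCompactSupport.of_compactSpace _)
        · exact Eventually.of_forall fun τ => mul_nonneg (Real.exp_nonneg _) (φ.deriv_pos τ).le
    _ = ∫⁻ τ : UnitAddCircle, (∫⁻ s in Set.Ioi (0 : ℝ), ENNReal.ofReal (
        Real.exp (c * φ.energy - s * φ.deriv τ) * φ.deriv τ)) :=
        lintegral_lintegral_swap hG.measurable.ennreal_ofReal.aemeasurable
    -- Since φ' > 0, the exponential density in s with rate φ'(τ) has mass one for each τ.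
    _ = ∫⁻ _ : UnitAddCircle, ENNReal.ofReal (Real.exp (c * φ.energy)) := by
        refine lintegral_congr fun τ => ?_
        have e : ∀ s : ℝ, ENNReal.ofReal (Real.exp (c * φ.energy - s * φ.deriv τ) * φ.deriv τ)
            = ENNReal.ofReal (Real.exp (c * φ.energy))
              * ENNReal.ofReal (Real.exp (-(s * φ.deriv τ)) * φ.deriv τ) := fun s => by
          rw [← ENNReal.ofReal_mul (Real.exp_nonneg _), ← mul_assoc, ← Real.exp_add, sub_eq_add_neg]
        simp only [e]
        rw [lintegral_const_mul _ (by fun_prop), lintegral_mul_exp_neg_mul_Ioi (φ.deriv_pos τ),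
          mul_one]
    _ = _ := by simp

theorem IsRegularOrbitalFamily.measure_univ_neg_sq_eq_lintegral {σsq : ℝ}
    {μ : ℝ → Measure (CircleDiff 1)} (hσ : 0 < σsq)
    (hμ : IsRegularOrbitalFamily σsq μ) {b δ : ℝ} (hb : 0 < b) (hδ : 0 < δ)
    (hfin : μ (-b ^ 2 + δ) Set.univ < ∞) :
    μ (-b ^ 2) Set.univ = ∫⁻ l in Set.Ioi b,
      ENNReal.ofReal (4 * b / (σsq * Real.sinh b) * Real.sinh l) * μ (-l ^ 2) Set.univ := by
  have := hμ.sFinite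
  have hs := Real.sinh_pos_iff.2 hb
  have hK : 0 < 4 * b / (σsq * Real.sinh b) := by positivity
  rw [hμ.measure_univ (-b ^ 2), ← lintegral_laplace_deriv, lintegral_Ioi_eq_lintegral_sinh hb hK]
  refine setLIntegral_congr_fun measurableSet_Ioi fun l hl => ?_
  rw [hμ.measure_univ_neg_sq_eq hσ hb hl hδ hfin]
  congr 1
  refine lintegral_congr fun φ => ?_
  congr 2
  funext τ
  congr 2
  field_simp

/-! ### Solving the integral equation -/

/-- A bootstrap: g(b) = z(b) sinh b / b is a tail integral of f, hence continuous; f = (4/v) b g is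
then continuous, so g is differentiable with g' = -(4b/v) g. -/
theorem exists_eq_of_integral_eq {v B : ℝ} (hB : 0 ≤ B) {z : ℝ → ℝ}
    (hint : ∀ b > B, IntegrableOn (fun l => 4 / v * (z l * Real.sinh l)) (Set.Ioi b))
    (heq : ∀ b > B, ∫ l in Set.Ioi b, 4 / v * (z l * Real.sinh l) = z b * Real.sinh b / b) :
    ∃ C, ∀ b > B, z b = C * (b / Real.sinh b) * Real.exp (-(2 * b ^ 2 / v)) := by
  set f : ℝ → ℝ := fun l => 4 / v * (z l * Real.sinh l) with hf
  set g : ℝ → ℝ := fun b => z b * Real.sinh b / b with hg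
  have hfg : ∀ b > B, f b = 4 / v * (b * g b) := fun b hb => by
    have : b ≠ 0 := (hB.trans_lt hb).ne'
    simp only [hf, hg]
    field_simp
  have hii : ∀ x y, B < x → B < y → IntervalIntegrable f volume x y := fun x y hx hy => by
    rw [intervalIntegrable_iff]
    -- The midpoint between B and the smaller endpoint: integrability is known only on rays starting
    -- strictly beyond B.
    refine (hint (min x y / 2 + B / 2) ?_).mono_set fun t ht => ?_
    · have := lt_min hx hy
      linarith
    · have := lt_min hx hy
      have := ht.1
      simp only [Set.mem_Ioi]
      linarith
  have hsub : ∀ x y, B < x → B < y → g y = g x - ∫ t in x..y, f t := fun x y hx hy => by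
    change z y * Real.sinh y / y = z x * Real.sinh x / x - _
    rw [← heq x hx, ← heq y hy]
    have := intervalIntegral.integral_Ioi_sub_Ioi' (hint x hx) (hint y hy)
    linarith
  have hgc : ∀ b > B, ContinuousAt g b := fun b hb => by
    obtain ⟨x, hx1, hx2⟩ := exists_between hb
    have h1 := intervalIntegral.continuousOn_primitive_interval' (hii x (b + 1) hx1 (by linarith))
      Set.left_mem_uIcc
    have h2 : ContinuousAt (fun y => ∫ t in x..y, f t) b := h1.continuousAt (by
      rw [Set.uIcc_of_le (by linarith)]
      exact Icc_mem_nhds hx2 (by linarith))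
    refine (continuousAt_const (y := g x) |>.sub h2).congr ?_
    filter_upwards [Ioi_mem_nhds hb] with y hy
    exact (hsub x y hx1 hy).symm
  have hfc : ∀ b > B, ContinuousAt f b := fun b hb => by
    refine (continuousAt_const (y := 4 / v) |>.mul (continuousAt_id.mul (hgc b hb))).congr ?_
    filter_upwards [Ioi_mem_nhds hb] with y hy
    exact (hfg y hy).symm
  have hfm : ∀ b > B, StronglyMeasurableAtFilter f (𝓝 b) := fun b hb =>
    ContinuousOn.stronglyMeasurableAtFilter (s := Set.Ioi B) isOpen_Ioi
      (fun x hx => (hfc x hx).continuousWithinAt) b hb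
  have hgd : ∀ b > B, HasDerivAt g (-f b) b := fun b hb => by
    obtain ⟨x, hx1, hx2⟩ := exists_between hb
    have h1 := intervalIntegral.integral_hasDerivAt_right (hii x b hx1 hb) (hfm b hb) (hfc b hb)
    refine (h1.const_sub (g x)).congr_of_eventuallyEq ?_
    filter_upwards [Ioi_mem_nhds hb] with y hy
    exact hsub x y hx1 hy
  -- The integrating factor of the differential equation for g.
  set u : ℝ → ℝ := fun b => g b * Real.exp (2 * b ^ 2 / v)
  have hud : ∀ b ∈ Set.Ioi B, HasDerivAt u 0 b := fun b hb => by
    have h1 : HasDerivAt (fun b : ℝ => 2 * b ^ 2 / v) (4 * b / v) b :=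
      (((hasDerivAt_pow 2 b).const_mul 2).div_const v).congr_deriv (by norm_num; ring)
    refine ((hgd b hb).mul h1.exp).congr_deriv ?_
    rw [hfg b hb]
    ring
  have hconst : ∀ b > B, u b = u (B + 1) := fun b hb =>
    isOpen_Ioi.is_const_of_deriv_eq_zero isPreconnected_Ioi
      (fun x hx => (hud x hx).differentiableAt.differentiableWithinAt)
      (fun x hx => (hud x hx).deriv) hb (by simp : B + 1 ∈ Set.Ioi B)
  refine ⟨u (B + 1), fun b hb => ?_⟩
  have hb0 : 0 < b := hB.trans_lt hb
  have hs := (Real.sinh_pos_iff.2 hb0).ne'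
  rw [← hconst b hb]
  simp only [u, hg]
  rw [Real.exp_neg]
  field_simp

theorem IsRegularOrbitalFamily.measure_univ_mono {σsq : ℝ} {μ : ℝ → Measure (CircleDiff 1)}
    (hσ : 0 < σsq) (hμ : IsRegularOrbitalFamily σsq μ) {a a' : ℝ} (h : a ≤ a') :
    μ a Set.univ ≤ μ a' Set.univ := by
  rw [hμ.measure_univ, hμ.measure_univ]
  refine lintegral_mono fun φ => ENNReal.ofReal_le_ofReal (Real.exp_le_exp.2 ?_)
  have := φ.energy_nonneg
  gcongr

/-- The total mass for large negative parameters. -/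
theorem IsRegularOrbitalFamily.exists_measure_univ_neg_sq_eq {σsq : ℝ}
    {μ : ℝ → Measure (CircleDiff 1)} (hσ : 0 < σsq) (hμ : IsRegularOrbitalFamily σsq μ) :
    ∃ B C : ℝ, 0 ≤ B ∧ ∀ b > B, μ (-b ^ 2) Set.univ < ∞ ∧
      (μ (-b ^ 2) Set.univ).toReal
        = C * (b / Real.sinh b) * Real.exp (-(2 * b ^ 2 / σsq)) := by
  obtain ⟨c, hc⟩ : ∃ c, μ c Set.univ < ∞ := by
    obtain ⟨a₀, hr, h⟩ := hμ
    obtain ⟨c, hc⟩ := hr.regular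
    exact ⟨c, by rwa [h c]⟩
  -- For b > 1 + |c| one has -b² + 1 ≤ c, so the margin δ = 1 is available.
  set B := 1 + |c| with hBdef
  have hB : 0 ≤ B := by positivity
  have hfin1 : ∀ b > B, μ (-b ^ 2 + 1) Set.univ < ∞ := fun b hb => by
    refine (hμ.measure_univ_mono hσ ?_).trans_lt hc
    have h1 := neg_abs_le c
    have h2 := abs_nonneg c
    nlinarith
  have hfin : ∀ b > B, μ (-b ^ 2) Set.univ < ∞ := fun b hb =>
    (hμ.measure_univ_mono hσ (by linarith)).trans_lt (hfin1 b hb)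
  set z : ℝ → ℝ := fun b => (μ (-b ^ 2) Set.univ).toReal
  have hzm : AntitoneOn z (Set.Ioi B) := fun x hx y hy hxy =>
    ENNReal.toReal_mono (hfin x hx).ne (hμ.measure_univ_mono hσ (by
      have : 0 ≤ x := hB.trans (le_of_lt hx)
      nlinarith))
  have hlint : ∀ b > B, ∫⁻ l in Set.Ioi b, ENNReal.ofReal (4 / σsq * (z l * Real.sinh l))
      = ENNReal.ofReal (z b * Real.sinh b / b) := fun b hb => by
    have hb0 : 0 < b := hB.trans_lt hb
    have hs := Real.sinh_pos_iff.2 hb0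
    have h1 := hμ.measure_univ_neg_sq_eq_lintegral hσ hb0 one_pos (hfin1 b hb)
    have h2 : ∀ l > B, μ (-l ^ 2) Set.univ = ENNReal.ofReal (z l) := fun l hl =>
      (ENNReal.ofReal_toReal (hfin l hl).ne).symm
    have h3 : ∫⁻ l in Set.Ioi b, ENNReal.ofReal (4 / σsq * (z l * Real.sinh l))
        = ENNReal.ofReal (Real.sinh b / b) * ∫⁻ l in Set.Ioi b,
      ENNReal.ofReal (4 * b / (σsq * Real.sinh b) * Real.sinh l) * μ (-l ^ 2) Set.univ := by
      rw [← lintegral_const_mul' _ _ ENNReal.ofReal_ne_top]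
      refine setLIntegral_congr_fun measurableSet_Ioi fun l hl => ?_
      have hl0 : 0 < l := hb0.trans hl
      have hsl := Real.sinh_pos_iff.2 hl0
      rw [h2 l (lt_trans hb hl), ← ENNReal.ofReal_mul (by positivity),
        ← ENNReal.ofReal_mul (by positivity)]
      congr 1
      field_simp
    rw [h3, ← h1, h2 b hb, ← ENNReal.ofReal_mul (by positivity)]
    congr 1
    ring
  have hnn : ∀ l > B, 0 ≤ 4 / σsq * (z l * Real.sinh l) := fun l hl => by
    have := Real.sinh_pos_iff.2 (hB.trans_lt hl)
    have : 0 ≤ z l := ENNReal.toReal_nonneg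
    positivity
  have hae : ∀ b > B, AEStronglyMeasurable (fun l => 4 / σsq * (z l * Real.sinh l))
      (volume.restrict (Set.Ioi b)) := fun b hb => by
    -- Monotonicity is the only regularity of z known at this point, and it suffices for
    -- measurability.
    have h1 : AEMeasurable z (volume.restrict (Set.Ioi b)) :=
      aemeasurable_restrict_of_antitoneOn measurableSet_Ioi
        (hzm.mono (Set.Ioi_subset_Ioi hb.le))
    exact ((h1.mul Real.measurable_sinh.aemeasurable).const_mul _).aestronglyMeasurable
  have hnnae : ∀ b > B, 0 ≤ᵐ[volume.restrict (Set.Ioi b)]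
      fun l => 4 / σsq * (z l * Real.sinh l) := fun b hb => by
    filter_upwards [ae_restrict_mem measurableSet_Ioi] with l hl
    exact hnn l (lt_trans hb hl)
  have hint : ∀ b > B, IntegrableOn (fun l => 4 / σsq * (z l * Real.sinh l)) (Set.Ioi b) :=
    fun b hb => ⟨hae b hb, by
      rw [hasFiniteIntegral_iff_ofReal (hnnae b hb), hlint b hb]
      exact ENNReal.ofReal_lt_top⟩
  obtain ⟨C, hC⟩ := exists_eq_of_integral_eq (v := σsq) hB hint fun b hb => by
    rw [integral_eq_lintegral_of_nonneg_ae (hnnae b hb) (hae b hb), hlint b hb,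
      ENNReal.toReal_ofReal]
    have hb0 : 0 < b := hB.trans_lt hb
    have := Real.sinh_pos_iff.2 hb0
    have : 0 ≤ z b := ENNReal.toReal_nonneg
    positivity
  exact ⟨B, C, hB, fun b hb => ⟨hfin b hb, hC b hb⟩⟩

end IntegralEquation

/-! ### The entire function `sin √w / √w` -/

/-- The entire function `w ↦ sin √w / √w`. -/
noncomputable def sincSqrt (w : ℂ) : ℂ :=
  ∑' n : ℕ, (-1) ^ n * w ^ n / ((2 * n + 1).factorial : ℂ)

theorem norm_sincSqrt_term_le {w : ℂ} {R : ℝ} (hw : ‖w‖ ≤ R) (n : ℕ) :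
    ‖(-1) ^ n * w ^ n / ((2 * n + 1).factorial : ℂ)‖ ≤ R ^ n / (n.factorial : ℝ) := by
  rw [norm_div, norm_mul, norm_pow, norm_pow, norm_neg, norm_one, one_pow, one_mul,
    Complex.norm_natCast]
  have h1 : (n.factorial : ℝ) ≤ ((2 * n + 1).factorial : ℝ) := by
    exact_mod_cast Nat.factorial_le (by omega)
  have h2 : (0 : ℝ) < n.factorial := by exact_mod_cast n.factorial_pos
  have h3 := (norm_nonneg w).trans hw
  gcongr

theorem differentiable_sincSqrt : Differentiable ℂ sincSqrt := by
  intro w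
  have h : DifferentiableOn ℂ sincSqrt (Metric.ball 0 (‖w‖ + 1)) :=
    Complex.differentiableOn_tsum_of_summable_norm (Real.summable_pow_div_factorial (‖w‖ + 1))
      (fun n => by fun_prop) Metric.isOpen_ball fun n x hx =>
        norm_sincSqrt_term_le (by simpa using (mem_ball_zero_iff.1 hx).le) n
  exact h.differentiableAt (Metric.isOpen_ball.mem_nhds (by simp))

theorem mul_sincSqrt_sq (z : ℂ) : z * sincSqrt (z ^ 2) = Complex.sin z := by
  rw [sincSqrt, ← tsum_mul_left, ← (Complex.hasSum_sin z).tsum_eq]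
  refine tsum_congr fun n => ?_
  ring

theorem sincSqrt_zero : sincSqrt 0 = 1 := by
  rw [sincSqrt, tsum_eq_single 0 fun n hn => by simp [hn]]
  simp

theorem inv_sincSqrt_sq (α : ℂ) : (sincSqrt (α ^ 2))⁻¹ = divSin α := by
  rw [divSin]
  split_ifs with h
  · rw [h, zero_pow two_ne_zero, sincSqrt_zero, inv_one]
  · rw [← mul_sincSqrt_sq, div_mul_eq_div_div, div_self h, one_div]

theorem sincSqrt_neg_sq {b : ℝ} (hb : b ≠ 0) :
    sincSqrt ((-b ^ 2 : ℝ) : ℂ) = ((Real.sinh b / b : ℝ) : ℂ) := by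
  have h := mul_sincSqrt_sq (b * Complex.I)
  rw [Complex.sin_mul_I, mul_pow, Complex.I_sq] at h
  have hb' : (b : ℂ) ≠ 0 := by exact_mod_cast hb
  push_cast
  rw [eq_div_iff hb']
  refine mul_right_cancel₀ Complex.I_ne_zero ?_
  rw [← h]
  ring_nf

/-- The zeros are (kπ)² with k ≠ 0, all real and at least π², hence outside a disc about a real
centre whose rightmost point is π². -/
theorem sincSqrt_ne_zero {w : ℂ} {c : ℝ}
    (hw : w ∈ Metric.ball (c : ℂ) (Real.pi ^ 2 - c)) : sincSqrt w ≠ 0 := by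
  intro h0
  obtain ⟨z, rfl⟩ : ∃ z : ℂ, z ^ 2 = w := ⟨w ^ (1 / 2 : ℂ), by
    rw [← Complex.cpow_nat_mul]; simp⟩
  have hsin : Complex.sin z = 0 := by rw [← mul_sincSqrt_sq, h0, mul_zero]
  obtain ⟨k, hk⟩ := Complex.sin_eq_zero_iff.1 hsin
  have hk0 : k ≠ 0 := by
    rintro rfl
    rw [hk] at h0
    simp [sincSqrt_zero] at h0
  have hk1 : (1 : ℝ) ≤ (k : ℝ) ^ 2 := by
    have : 0 < k ^ 2 := by positivity
    exact_mod_cast this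
  rw [hk, Metric.mem_ball, dist_eq_norm,
    show ((k : ℂ) * Real.pi) ^ 2 - (c : ℂ) = (((k * Real.pi) ^ 2 - c : ℝ) : ℂ) by push_cast; ring,
    Complex.norm_real, Real.norm_eq_abs] at hw
  have h1 : Real.pi ^ 2 ≤ (k * Real.pi) ^ 2 := by
    rw [mul_pow]
    nlinarith [sq_nonneg Real.pi]
  have := le_abs_self ((k * Real.pi) ^ 2 - c)
  linarith

/-! ### Analytic continuation of a Laplace transform of a positive measure -/

section Continuation

open ProbabilityTheory

/-- Expand exp(aX) about c: for a ≥ c and X ≥ 0 every term is nonnegative, so sum and integral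
commute with no prior integrability at a. Finiteness is a conclusion. -/
theorem lintegral_exp_eq_of_hasSum {Ω : Type*} [MeasurableSpace Ω] {ν : Measure Ω} {X : Ω → ℝ}
    (hX : Measurable X) (hX0 : ∀ ω, 0 ≤ X ω) {c a s : ℝ} (hca : c ≤ a)
    (hc : c ∈ interior (integrableExpSet X ν))
    (h : HasSum (fun n : ℕ => (n.factorial : ℝ)⁻¹ *
      ((a - c) ^ n * ∫ ω, X ω ^ n * Real.exp (c * X ω) ∂ν)) s) :
    ∫⁻ ω, ENNReal.ofReal (Real.exp (a * X ω)) ∂ν = ENNReal.ofReal s := by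
  have hac : 0 ≤ a - c := sub_nonneg.2 hca
  have hnn : ∀ n ω, 0 ≤ X ω ^ n * Real.exp (c * X ω) := fun n ω =>
    mul_nonneg (pow_nonneg (hX0 ω) n) (Real.exp_nonneg _)
  have hexp : ∀ ω, ENNReal.ofReal (Real.exp (a * X ω))
      = ∑' n : ℕ, ENNReal.ofReal ((n.factorial : ℝ)⁻¹ * (a - c) ^ n)
        * ENNReal.ofReal (X ω ^ n * Real.exp (c * X ω)) := fun ω => by
    have h1 := NormedSpace.expSeries_div_hasSum_exp (𝔸 := ℝ) ((a - c) * X ω)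
    rw [← Real.exp_eq_exp_ℝ] at h1
    have h2 := h1.mul_right (Real.exp (c * X ω))
    rw [← Real.exp_add, show (a - c) * X ω + c * X ω = a * X ω by ring] at h2
    have h3 : (fun n : ℕ => ((a - c) * X ω) ^ n / (n.factorial : ℝ) * Real.exp (c * X ω))
        = fun n => (n.factorial : ℝ)⁻¹ * (a - c) ^ n * (X ω ^ n * Real.exp (c * X ω)) := by
      funext n
      rw [mul_pow]
      ring
    rw [h3] at h2
    rw [← h2.tsum_eq, ENNReal.ofReal_tsum_of_nonneg
      (fun n => mul_nonneg (by positivity) (hnn n ω)) h2.summable]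
    exact tsum_congr fun n => ENNReal.ofReal_mul (by positivity)
  simp only [hexp]
  rw [lintegral_tsum fun n => by fun_prop, ← h.tsum_eq, ENNReal.ofReal_tsum_of_nonneg _ h.summable]
  · refine tsum_congr fun n => ?_
    rw [lintegral_const_mul _ (by fun_prop), ← mul_assoc,
      ENNReal.ofReal_mul (q := ∫ ω, X ω ^ n * Real.exp (c * X ω) ∂ν) (by positivity),
      ofReal_integral_eq_lintegral_ofReal
        (integrable_pow_mul_exp_of_mem_interior_integrableExpSet hc n)
        (Eventually.of_forall (hnn n))]
  · intro n
    have := integral_nonneg (μ := ν) (f := fun ω => X ω ^ n * Real.exp (c * X ω)) (hnn n)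
    positivity

/-- A Laplace transform of a positive measure that coincides near `c` with a function holomorphic
in a disc around `c` coincides with it on the real points of the disc to the right of `c`. -/
theorem lintegral_exp_eq_of_eventuallyEq {Ω : Type*} [MeasurableSpace Ω] {ν : Measure Ω}
    {X : Ω → ℝ} (hX : Measurable X) (hX0 : ∀ ω, 0 ≤ X ω) {c r : ℝ} (hr : 0 < r)
    (hc : c ∈ interior (integrableExpSet X ν)) {G : ℂ → ℂ}
    (hG : DifferentiableOn ℂ G (Metric.ball (c : ℂ) r))
    (heq : ∀ᶠ x : ℝ in 𝓝 c, G x = (mgf X ν x : ℝ)) {a : ℝ} (hca : c ≤ a) (har : a < c + r) :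
    ∫⁻ ω, ENNReal.ofReal (Real.exp (a * X ω)) ∂ν = ENNReal.ofReal (G a).re ∧
      0 ≤ (G a).re ∧ (G a).im = 0 := by
  have hGa : AnalyticAt ℂ G c := hG.analyticAt (Metric.isOpen_ball.mem_nhds (by simpa using hr))
  have hMa : AnalyticAt ℂ (complexMGF X ν) c := analyticAt_complexMGF (by simpa using hc)
  have hfreq : ∃ᶠ w in 𝓝[≠] (c : ℂ), G w = complexMGF X ν w := by
    have h1 : ∀ᶠ x : ℝ in 𝓝[≠] c, G x = complexMGF X ν x := by
      filter_upwards [heq.filter_mono nhdsWithin_le_nhds] with x hx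
      rw [hx, complexMGF_ofReal]
    have ht : Tendsto (fun x : ℝ => (x : ℂ)) (𝓝[≠] c) (𝓝[≠] (c : ℂ)) :=
      tendsto_nhdsWithin_iff.2 ⟨(Complex.continuous_ofReal.tendsto c).mono_left nhdsWithin_le_nhds,
        by filter_upwards [self_mem_nhdsWithin] with x hx
           simpa using hx⟩
    exact ht.frequently h1.frequently
  -- Agreement on a real punctured neighbourhood extends to a complex one by the identity theorem,
  -- so the Taylor coefficients of G are moments.
  have hev : G =ᶠ[𝓝 (c : ℂ)] complexMGF X ν :=
    (hGa.frequently_eq_iff_eventually_eq hMa).1 hfreq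
  have hder : ∀ n : ℕ, iteratedDeriv n G c
      = ((∫ ω, X ω ^ n * Real.exp (c * X ω) ∂ν : ℝ) : ℂ) := fun n => by
    rw [hev.iteratedDeriv_eq n, iteratedDeriv_complexMGF (by simpa using hc) n,
      ← integral_complex_ofReal]
    refine integral_congr_ae (Eventually.of_forall fun ω => ?_)
    push_cast
    rfl
  have hsum := Complex.hasSum_taylorSeries_on_ball hG (z := (a : ℂ)) (by
    rw [Metric.mem_ball, dist_eq_norm, ← Complex.ofReal_sub, Complex.norm_real, Real.norm_eq_abs,
      abs_of_nonneg (sub_nonneg.2 hca)]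
    linarith)
  have hterm : (fun n : ℕ => ((n.factorial : ℂ))⁻¹ • ((a : ℂ) - c) ^ n • iteratedDeriv n G c)
      = fun n : ℕ => (((n.factorial : ℝ)⁻¹ * ((a - c) ^ n
        * ∫ ω, X ω ^ n * Real.exp (c * X ω) ∂ν) : ℝ) : ℂ) := by
    funext n
    rw [hder]
    simp only [smul_eq_mul]
    push_cast
    rfl
  rw [hterm] at hsum
  have hre := Complex.hasSum_re hsum
  have him := Complex.hasSum_im hsum
  simp only [Complex.ofReal_re] at hre
  simp only [Complex.ofReal_im] at him
  refine ⟨lintegral_exp_eq_of_hasSum hX hX0 hca hc hre, hre.nonneg fun n => ?_, him.unique hasSum_zero⟩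
  have h1 : 0 ≤ a - c := sub_nonneg.2 hca
  have h2 := integral_nonneg (μ := ν) (f := fun ω => X ω ^ n * Real.exp (c * X ω))
    fun ω => mul_nonneg (pow_nonneg (hX0 ω) n) (Real.exp_nonneg _)
  positivity

/-! ### The partition function -/

theorem IsRegularOrbitalFamily.exists_measure_univ_eq {σsq : ℝ}
    {μ : ℝ → Measure (CircleDiff 1)} (hσ : 0 < σsq) (hμ : IsRegularOrbitalFamily σsq μ) :
    ∃ C : ℝ, ∀ a < Real.pi ^ 2, μ a Set.univ < ∞ ∧
      (((μ a Set.univ).toReal : ℝ) : ℂ) = C * (Complex.exp (2 * a / σsq) * (sincSqrt a)⁻¹) := by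
  obtain ⟨B, C, hB, hBC⟩ := hμ.exists_measure_univ_neg_sq_eq hσ
  set G : ℂ → ℂ := fun w => C * (Complex.exp (2 * w / σsq) * (sincSqrt w)⁻¹) with hGdef
  -- the formula left of `-B ^ 2`
  have hleft : ∀ a < -B ^ 2, μ a Set.univ < ∞ ∧ (((μ a Set.univ).toReal : ℝ) : ℂ) = G a := by
    intro a ha
    have hb : B < Real.sqrt (-a) := Real.lt_sqrt_of_sq_lt (by linarith)
    have hsq : -Real.sqrt (-a) ^ 2 = a := by
      rw [Real.sq_sqrt (by nlinarith), neg_neg]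
    obtain ⟨h1, h2⟩ := hBC _ hb
    have h3 := sincSqrt_neg_sq (hB.trans_lt hb).ne'
    rw [hsq] at h1 h2 h3
    refine ⟨h1, ?_⟩
    rw [h2, hGdef]
    beta_reduce
    rw [h3, show -(2 * Real.sqrt (-a) ^ 2 / σsq) = 2 * a / σsq by
      linear_combination 2 / σsq * hsq]
    push_cast
    rw [inv_div]
    ring
  set X : CircleDiff 1 → ℝ := fun φ => 2 / σsq * φ.energy with hXdef
  have hXm : Measurable X := (continuous_const.mul CircleDiff.continuous_energy).measurable
  have hX0 : ∀ φ, 0 ≤ X φ := fun φ => by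
    have := φ.energy_nonneg
    positivity
  have hZ : ∀ a, μ a Set.univ = ∫⁻ φ, ENNReal.ofReal (Real.exp (a * X φ)) ∂μ 0 := fun a => by
    rw [hμ.measure_univ]
    refine lintegral_congr fun φ => ?_
    simp only [hXdef]
    congr 2
    ring
  have hexpm : ∀ a, Measurable fun φ => Real.exp (a * X φ) := fun a => by fun_prop
  have hmgf : ∀ a, mgf X (μ 0) a = (μ a Set.univ).toReal := fun a => by
    rw [mgf, integral_eq_lintegral_of_nonneg_ae (Eventually.of_forall fun φ => Real.exp_nonneg _)
      (hexpm a).aestronglyMeasurable, hZ]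
  -- Any point of the open ray where the formula is known would do as centre; the disc of radius π²
  -- - c then contains all of [c, π²).
  set c : ℝ := -B ^ 2 - 1 with hcdef
  have hc0 : c ≤ 0 := by nlinarith
  have hcint : c ∈ interior (integrableExpSet X (μ 0)) := by
    refine mem_interior.2 ⟨Set.Iio (-B ^ 2), fun a ha => ?_, isOpen_Iio, by
      simp only [Set.mem_Iio, hcdef]; linarith⟩
    refine ⟨(hexpm a).aestronglyMeasurable, ?_⟩
    rw [hasFiniteIntegral_iff_ofReal (Eventually.of_forall fun φ => Real.exp_nonneg _), ← hZ]
    exact (hleft a ha).1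
  have hG : DifferentiableOn ℂ G (Metric.ball (c : ℂ) (Real.pi ^ 2 - c)) := by
    intro w hw
    have h1 := differentiable_sincSqrt w
    have h2 := sincSqrt_ne_zero hw
    have h3 : DifferentiableAt ℂ (fun w : ℂ => Complex.exp (2 * w / σsq)) w := by fun_prop
    exact ((h3.mul (h1.inv h2)).const_mul _).differentiableWithinAt
  have heq : ∀ᶠ x : ℝ in 𝓝 c, G x = (mgf X (μ 0) x : ℝ) := by
    filter_upwards [Iio_mem_nhds (show c < -B ^ 2 by rw [hcdef]; linarith)] with x hx
    rw [hmgf, (hleft x hx).2]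
  refine ⟨C, fun a ha => ?_⟩
  rcases lt_or_ge a c with hac | hac
  · exact hleft a (hac.trans (by rw [hcdef]; linarith))
  · obtain ⟨h1, h2, h3⟩ := lintegral_exp_eq_of_eventuallyEq hXm hX0
      (by have := Real.pi_pos; nlinarith : 0 < Real.pi ^ 2 - c) hcint hG heq hac (by linarith)
    rw [← hZ] at h1
    refine ⟨h1 ▸ ENNReal.ofReal_lt_top, ?_⟩
    rw [h1, ENNReal.toReal_ofReal h2]
    exact Complex.ext (by simp [hGdef]) (by rw [Complex.ofReal_im, ← h3])

end Continuation

theorem mainTheorem3 (σsq : ℝ) (hσ : 0 < σsq) (μ : ℝ → Measure (CircleDiff 1))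
    (hμ : IsRegularOrbitalFamily σsq μ) :
    (∀ a : ℝ, a < Real.pi ^ 2 → μ a Set.univ < ∞) ∧
    ∀ (a : ℝ) (α : ℂ), α ^ 2 = (a : ℂ) → a < Real.pi ^ 2 →
      (((μ a Set.univ).toReal : ℝ) : ℂ) =
        divSin α * Complex.exp (2 * α ^ 2 / (σsq : ℂ)) * (((μ 0 Set.univ).toReal : ℝ) : ℂ) := by
  obtain ⟨C, hC⟩ := hμ.exists_measure_univ_eq hσ
  refine ⟨fun a ha => (hC a ha).1, fun a α hα ha => ?_⟩
  -- Since 0 < π², the formula may be evaluated at a = 0, which identifies C with the mass of `μ 0`.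
  have h0 := (hC 0 (by have := Real.pi_pos; positivity)).2
  simp only [Complex.ofReal_zero, mul_zero, zero_div, Complex.exp_zero, sincSqrt_zero, inv_one,
    mul_one] at h0
  rw [h0, (hC a ha).2, ← hα, inv_sincSqrt_sq]
  ring
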